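/- Let $n\ge 2$, and let $(X_{i,j})$, $i,j\ge 1$, $i+j\le n$, be independent random variables, each exponentially distributed with rate $1$. For boxes $(a,b),(c,d)$ of positive integers, let $L(a,b;c,d)$ be the last passage time $$L(a,b;c,d)=\max_{\pi}\sum_{(i,j)\in\pi}X_{i,j},$$ where the maximum is over all directed lattice paths $\pi$ from $(a,b)$ to $(c,d)$, that is, all sequences $\big((i_k,j_k)\big)_{k=0}^m$ of minimal length $m=|c-a|+|d-b|$ with $(i_0,j_0)=(a,b)$, $(i_m,j_m)=(c,d)$ and $|i_{k+1}-i_k|+|j_{k+1}-j_k|=1$ for $0\le k<m$. Then the random vectors $$V_n=\big(L(1,1;n-k,k)\big)_{k=1}^{n-1}\qquad\text{and}\qquad W_n=\big(L(n-k,1;1,k)\big)_{k=1}^{n-1}$$ have the same joint distribution. (All the paths involved stay inside $\{(i,j): i,j\ge1,\ i+j\le n\}$.) -/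

import Mathlib

open MeasureTheory ProbabilityTheory

/-- The `ℓ¹` distance `|c - a| + |d - b|` between the lattice points `(a, b)` and `(c, d)`. -/
def latticeDist (u v : ℕ × ℕ) : ℕ :=
  ((v.1 : ℤ) - u.1).natAbs + ((v.2 : ℤ) - u.2).natAbs

/-- Directed lattice paths from `u` to `v`: sequences of lattice points with `latticeDist u v`
steps (the minimal possible number), starting at `u`, ending at `v`, and with consecutive points
at `ℓ¹` distance one. -/
def directedPaths (u v : ℕ × ℕ) : Set (Fin (latticeDist u v + 1) → ℕ × ℕ) :=
  {π | π 0 = u ∧ π (Fin.last _) = v ∧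
    ∀ k : Fin (latticeDist u v), latticeDist (π k.castSucc) (π k.succ) = 1}

/-- The last passage time from `u` to `v` in the environment of weights `x`: the maximum, over all
directed lattice paths from `u` to `v`, of the sum of the weights along the path. The set of these
sums is finite and nonempty, so that its supremum is a maximum: see `isGreatest_lastPassage`. -/
noncomputable def lastPassage (x : ℕ × ℕ → ℝ) (u v : ℕ × ℕ) : ℝ :=
  sSup ((fun π : Fin (latticeDist u v + 1) → ℕ × ℕ => ∑ k, x (π k)) '' directedPaths u v)

theorem directedPaths_nonempty (u v : ℕ × ℕ) : (directedPaths u v).Nonempty := by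
  obtain ⟨a, b⟩ := u
  obtain ⟨c, d⟩ := v
  let g : ℕ → ℕ → ℕ → ℕ := fun a c k => a + min k (c - a) - min k (a - c)
  have g_step : ∀ a c k : ℕ, k < ((c : ℤ) - a).natAbs →
      ((g a c (k + 1) : ℤ) - g a c k).natAbs = 1 := by
    intro a c k hk
    simp only [g]
    rcases le_total a c with h | h
    · rw [Nat.sub_eq_zero_of_le h]; omega
    · rw [Nat.sub_eq_zero_of_le h]; omega
  have g_end : ∀ a c k : ℕ, ((c : ℤ) - a).natAbs ≤ k → g a c k = c := by
    intro a c k hk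
    simp only [g]
    omega
  have g_zero : ∀ a c : ℕ, g a c 0 = a := by simp [g]
  obtain ⟨D, hD⟩ : ∃ D, D = ((c : ℤ) - a).natAbs := ⟨_, rfl⟩
  have hdist : latticeDist (a, b) (c, d) = D + ((d : ℤ) - b).natAbs := by rw [hD]; rfl
  refine ⟨fun k => (g a c k, g b d (k - D)), by simp [g_zero], ?_, fun k => ?_⟩
  · simp only [Fin.val_last, Prod.mk.injEq]
    exact ⟨g_end _ _ _ (by omega), g_end _ _ _ (by omega)⟩
  · have hk : k.1 < D + ((d : ℤ) - b).natAbs := hdist ▸ k.2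
    change ((g a c (k.1 + 1) : ℤ) - g a c k.1).natAbs
      + ((g b d (k.1 + 1 - D) : ℤ) - g b d (k.1 - D)).natAbs = 1
    rcases lt_or_ge k.1 D with h | h
    · rw [g_step a c k (by omega), Nat.sub_eq_zero_of_le h.le, Nat.sub_eq_zero_of_le h]
      simp
    · rw [g_end a c k (by omega), g_end a c (k + 1) (by omega), Nat.sub_add_comm h,
        g_step b d (k - D) (by omega)]
      simp

theorem directedPaths_finite (u v : ℕ × ℕ) : (directedPaths u v).Finite := by
  have hfin : (Set.univ.pi fun _ : Fin (latticeDist u v + 1) =>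
      Set.Iic (u.1 + latticeDist u v, u.2 + latticeDist u v)).Finite :=
    Set.Finite.pi fun _ => Set.finite_Iic _
  refine hfin.subset fun π hπ k _ => ?_
  obtain ⟨h0, -, hs⟩ := hπ
  have key : ∀ m (hm : m < latticeDist u v + 1),
      (π ⟨m, hm⟩).1 ≤ u.1 + m ∧ (π ⟨m, hm⟩).2 ≤ u.2 + m := by
    intro m
    induction m with
    | zero => intro hm; simp [← h0]
    | succ m ih =>
      intro hm
      have h1 := ih (by omega)
      have h2 := hs ⟨m, by omega⟩
      simp only [Fin.castSucc_mk, Fin.succ_mk] at h2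
      have h3 : ∀ p q : ℕ × ℕ, latticeDist p q = 1 → q.1 ≤ p.1 + 1 ∧ q.2 ≤ p.2 + 1 := by
        intro p q h
        simp only [latticeDist] at h
        omega
      have h4 := h3 _ _ h2
      omega
  have h := key k.1 k.2
  have hk := k.2
  simp only [Set.mem_Iic, Prod.le_def]
  constructor <;> simp only [Fin.eta] at h ⊢ <;> omega

theorem isGreatest_lastPassage (x : ℕ × ℕ → ℝ) (u v : ℕ × ℕ) :
    IsGreatest ((fun π : Fin (latticeDist u v + 1) → ℕ × ℕ => ∑ k, x (π k)) '' directedPaths u v)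
      (lastPassage x u v) :=
  have hf := (directedPaths_finite u v).image
    (fun π : Fin (latticeDist u v + 1) → ℕ × ℕ => ∑ k, x (π k))
  ⟨((directedPaths_nonempty u v).image _).csSup_mem hf, fun _ h => le_csSup hf.bddAbove h⟩

/-- The boxes `(i, j)`, `i, j ≥ 1`, of the staircase Young diagram `(n - 1, n - 2, …, 1)`. -/
def staircase (n : ℕ) : Set (ℕ × ℕ) :=
  {p | 1 ≤ p.1 ∧ 1 ≤ p.2 ∧ p.1 + p.2 ≤ n}

/-- The point-to-line vector `(L(1,1; n-1,1), L(1,1; n-2,2), …, L(1,1; 1,n-1))`. The component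
with index `k : Fin (n - 1)` is the one usually numbered `k + 1`. -/
noncomputable def pointToLine (n : ℕ) (x : ℕ × ℕ → ℝ) : Fin (n - 1) → ℝ :=
  fun k => lastPassage x (1, 1) (n - (k + 1), k + 1)

/-- The line-to-line vector `(L(n-1,1; 1,1), L(n-2,1; 1,2), …, L(1,1; 1,n-1))`. The component
with index `k : Fin (n - 1)` is the one usually numbered `k + 1`. -/
noncomputable def lineToLine (n : ℕ) (x : ℕ × ℕ → ℝ) : Fin (n - 1) → ℝ :=
  fun k => lastPassage x (n - (k + 1), 1) (1, k + 1)

/-! Both vectors are read off the antidiagonal `n` of arrays built from the same weights by local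
moves: the Robinson–Schensted–Knuth array (`rskChain`) and the Burge array (`burgeChain`). The two
arrays have the same law, although they differ for given weights.

Equality of laws. Processing antidiagonal m adds to each of its entries the larger of the two
preceding ones, and reflects the entries on antidiagonals m - 2, m - 4, … in the interval allowed by
their neighbours. Each operation replaces one coordinate by ± itself plus a function of the others,
so volume is preserved. Nonnegative weights become monotone arrays (`interlaced_rskStep_iff`), and
because min + max is the sum, an alternating sum of antidiagonal sums keeps track of the total
weight (`energy_rskStep`). The Burge scheme precedes each step by involutions `burgeMove` with the
same three invariances. Hence both schemes push the density exp(-total weight) to one and the same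
density (`map_rskChain_eq_map_burgeChain`).

Identification. On the newest antidiagonal the RSK rule is the recursion for L(1,1;i,j). For Burge,
the diagonals of the array are partitions (`burgeShape`), and inserting a row of weights is a series
of queues. Passage through two lines is unchanged when they are exchanged through a queue
(`lineOp_lineOp_queue`), so the rows of weights may be replaced by the increments of the parts
(`stackOp_burgeShape`). Through those lines the passage time telescopes to the first part
(`burgeChain_eq_stackOp`). The lines are crossed from row j down to row 1, which gives L(i,1;1,j).
-/

/-! ### Lebesgue measure under one-coordinate changes; product densities -/

/-- By Fubini the coordinate `q` may be integrated first; for fixed other coordinates the map is a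
translation or a reflection of the line. -/
theorem measurePreserving_update_affine {ι : Type*} [Fintype ι] [DecidableEq ι] (q : ι) {ε : ℝ}
    (hε : ε = 1 ∨ ε = -1) {φ : (ι → ℝ) → ℝ} (hφ : Measurable φ)
    (hq : ∀ t v, φ (Function.update t q v) = φ t) :
    MeasurePreserving (fun t => Function.update t q (ε * t q + φ t)) := by
  have hm : Measurable (fun t : ι → ℝ => Function.update t q (ε * t q + φ t)) := by
    refine measurable_pi_lambda _ fun p => ?_
    rcases eq_or_ne p q with rfl | h
    · simp only [Function.update_self]; fun_prop
    · simp only [Function.update_of_ne h]; fun_prop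
  refine ⟨hm, Measure.ext_of_lintegral _ fun f hf => ?_⟩
  rw [lintegral_map hf hm]
  have hinner : ∀ (c : ℝ) (g : ℝ → ENNReal), ∫⁻ y, g (ε * y + c) = ∫⁻ y, g y := by
    intro c g
    rcases hε with rfl | rfl
    · simpa using lintegral_add_right_eq_self g c
    · simpa [neg_add_eq_sub] using lintegral_sub_left_eq_self (μ := volume) g c
  rw [volume_pi, lintegral_eq_lmarginal_univ (fun _ => (0 : ℝ)),
    lintegral_eq_lmarginal_univ (fun _ => (0 : ℝ)),
    lmarginal_erase' _ (show Measurable fun t => f (Function.update t q (ε * t q + φ t)) from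
      hf.comp hm) (Finset.mem_univ q), lmarginal_erase' _ hf (Finset.mem_univ q)]
  congr 2
  funext t
  simp only [Function.update_idem, Function.update_self, hq]
  exact hinner (φ t) fun y => f (Function.update t q y)

theorem lintegral_fintype_prod {ι : Type*} [Fintype ι] (μ : ι → Measure ℝ)
    [∀ i, SigmaFinite (μ i)] {f : ι → ℝ → ENNReal} (hf : ∀ i, Measurable (f i)) :
    ∫⁻ t, ∏ i, f i (t i) ∂(Measure.pi μ) = ∏ i, ∫⁻ y, f i y ∂(μ i) := by
  classical
  have hF : Measurable fun t : ι → ℝ => ∏ i, f i (t i) :=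
    Finset.measurable_fun_prod _ fun i _ => (hf i).comp (measurable_pi_apply i)
  have key : ∀ (s : Finset ι) (x : ι → ℝ), (∫⋯∫⁻_s, (fun t => ∏ i, f i (t i)) ∂μ) x =
      (∏ i ∈ s, ∫⁻ y, f i y ∂(μ i)) * ∏ i ∈ sᶜ, f i (x i) := by
    intro s
    induction s using Finset.induction_on with
    | empty => simp
    | insert i s hi ih =>
      intro x
      have hc : sᶜ = insert i (insert i s)ᶜ := by
        ext j; by_cases h : j = i <;> simp [h, hi]
      have hi' : i ∉ (insert i s)ᶜ := by simp
      have hu : ∀ y, ∏ j ∈ (insert i s)ᶜ, f j (Function.update x i y j) =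
          ∏ j ∈ (insert i s)ᶜ, f j (x j) := fun y => Finset.prod_congr rfl fun j hj => by
        rw [Function.update_of_ne (ne_of_mem_of_not_mem hj hi')]
      rw [lmarginal_insert _ hF hi, Finset.prod_insert hi]
      simp only [ih]
      rw [hc]
      simp only [Finset.prod_insert hi', Function.update_self, hu]
      rw [lintegral_const_mul _ ((hf i).mul_const _), lintegral_mul_const _ (hf i)]
      ring
  rw [lintegral_eq_lmarginal_univ (fun _ => 0), key]
  simp

theorem pi_withDensity {ι : Type*} [Fintype ι] (μ : ι → Measure ℝ) [∀ i, SigmaFinite (μ i)]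
    {f : ι → ℝ → ENNReal} (hf : ∀ i, Measurable (f i))
    [∀ i, SigmaFinite ((μ i).withDensity (f i))] :
    Measure.pi (fun i => (μ i).withDensity (f i)) =
      (Measure.pi μ).withDensity fun t => ∏ i, f i (t i) := by
  refine Measure.pi_eq fun s hs => ?_
  rw [withDensity_apply _ (MeasurableSet.univ_pi hs), ← lintegral_indicator (MeasurableSet.univ_pi hs)]
  have : ∀ t : ι → ℝ, (Set.univ.pi s).indicator (fun t => ∏ i, f i (t i)) t =
      ∏ i, (s i).indicator (f i) (t i) := by
    intro t
    by_cases h : t ∈ Set.univ.pi s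
    · rw [Set.indicator_of_mem h]
      exact Finset.prod_congr rfl fun i _ => (Set.indicator_of_mem (h i trivial) _).symm
    · rw [Set.indicator_of_notMem h]
      simp only [Set.mem_pi, not_forall] at h
      obtain ⟨i, -, hi⟩ := h
      exact (Finset.prod_eq_zero (Finset.mem_univ i) (Set.indicator_of_notMem hi _)).symm
  simp only [this]
  rw [lintegral_fintype_prod μ fun i => (hf i).indicator (hs i)]
  refine Finset.prod_congr rfl fun i _ => ?_
  rw [lintegral_indicator (hs i), withDensity_apply _ (hs i)]

/-- No inverse of `T` is needed: the source density is the pullback of `g`. -/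
theorem map_withDensity_comp {α β : Type*} [MeasurableSpace α] [MeasurableSpace β] {μ : Measure α}
    {ν : Measure β} {T : α → β} (hT : MeasurePreserving T μ ν) {f : α → ENNReal} {g : β → ENNReal}
    (hg : Measurable g) (h : ∀ a, g (T a) = f a) :
    (μ.withDensity f).map T = ν.withDensity g := by
  ext s hs
  rw [Measure.map_apply hT.measurable hs, withDensity_apply _ (hT.measurable hs),
    withDensity_apply _ hs, ← hT.setLIntegral_comp_preimage hs hg]
  simp only [h]

/-! ### Volume-preserving maps of finitely supported arrays -/

/-- The extension by zero of a function defined on `S`. -/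
noncomputable def extendZero {α : Type*} {S : Set α} (t : S → ℝ) : α → ℝ :=
  Function.extend Subtype.val t 0

section extendZero

variable {α : Type*} {S : Set α}

theorem extendZero_coe (t : S → ℝ) (p : S) : extendZero t p = t p :=
  Subtype.val_injective.extend_apply _ _ _

theorem extendZero_of_notMem (t : S → ℝ) {p : α} (hp : p ∉ S) : extendZero t p = 0 := by
  rw [extendZero, Function.extend_apply' _ _ _ (by rintro ⟨q, rfl⟩; exact hp q.2)]
  rfl

theorem extendZero_restrict {u : α → ℝ} (hu : ∀ p ∉ S, u p = 0) :
    extendZero (S.domRestrict u) = u := by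
  funext p
  by_cases hp : p ∈ S
  · exact extendZero_coe (S.domRestrict u) ⟨p, hp⟩
  · rw [extendZero_of_notMem _ hp, hu p hp]

theorem measurable_extendZero : Measurable (extendZero : (S → ℝ) → α → ℝ) := by
  refine measurable_pi_lambda _ fun p => ?_
  by_cases hp : p ∈ S
  · simpa only [extendZero_coe _ (⟨p, hp⟩ : S)] using
      (measurable_pi_apply (⟨p, hp⟩ : S) : Measurable fun t : S → ℝ => t ⟨p, hp⟩)
  · simp only [extendZero_of_notMem _ hp, measurable_const]

theorem extendZero_update [DecidableEq α] [DecidableEq S] (t : S → ℝ) (q : S) (v : ℝ) :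
    extendZero (Function.update t q v) = Function.update (extendZero t) q v := by
  funext p
  by_cases hp : p ∈ S
  · rw [extendZero_coe _ (⟨p, hp⟩ : S)]
    rcases eq_or_ne (⟨p, hp⟩ : S) q with rfl | h
    · simp
    · rw [Function.update_of_ne h, Function.update_of_ne (fun h' => h (Subtype.ext h')),
        extendZero_coe _ (⟨p, hp⟩ : S)]
  · rw [extendZero_of_notMem _ hp, Function.update_of_ne (ne_of_mem_of_not_mem q.2 hp).symm,
      extendZero_of_notMem _ hp]

end extendZero

/-- A transformation of functions on `α` preserving both the functions supported in `S` and the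
Lebesgue measure on them. -/
structure PreservesVolumeOn {α : Type*} (S : Set α) [Fintype S] (T : (α → ℝ) → α → ℝ) :
    Prop where
  eq_zero : ∀ u : α → ℝ, (∀ p ∉ S, u p = 0) → ∀ p ∉ S, T u p = 0
  measurePreserving : MeasurePreserving fun t : S → ℝ => S.domRestrict (T (extendZero t))

namespace PreservesVolumeOn

variable {α : Type*} {S : Set α} [Fintype S]

theorem extendZero_apply {T : (α → ℝ) → α → ℝ} (hT : PreservesVolumeOn S T) (t : S → ℝ) :
    extendZero (S.domRestrict (T (extendZero t))) = T (extendZero t) :=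
  extendZero_restrict (hT.eq_zero _ fun _ => extendZero_of_notMem t)

theorem id : PreservesVolumeOn S fun u => u where
  eq_zero _ h := h
  measurePreserving := by
    have h : (fun t : S → ℝ => S.domRestrict (extendZero t)) = _root_.id :=
      funext fun t => funext fun p => extendZero_coe t p
    exact h ▸ MeasurePreserving.id volume

theorem comp {T U : (α → ℝ) → α → ℝ} (hT : PreservesVolumeOn S T) (hU : PreservesVolumeOn S U) :
    PreservesVolumeOn S fun u => T (U u) where
  eq_zero u h := hT.eq_zero _ (hU.eq_zero u h)
  measurePreserving := by
    convert hT.measurePreserving.comp hU.measurePreserving using 1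
    funext t
    simp only [Function.comp_apply, hU.extendZero_apply]

theorem update [DecidableEq α] {q : α} (hq : q ∈ S) {ε : ℝ} (hε : ε = 1 ∨ ε = -1)
    {φ : (α → ℝ) → ℝ} (hφ : Measurable φ) (hφq : ∀ u v, φ (Function.update u q v) = φ u) :
    PreservesVolumeOn S fun u => Function.update u q (ε * u q + φ u) where
  eq_zero u h p hp := by
    rw [Function.update_of_ne (ne_of_mem_of_not_mem hq hp).symm]
    exact h p hp
  measurePreserving := by
    classical
    convert measurePreserving_update_affine (⟨q, hq⟩ : S) hε (φ := fun t => φ (extendZero t))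
      (hφ.comp measurable_extendZero) (fun t v => ?_) using 1
    · funext t p
      have := congrFun (extendZero_update t ⟨q, hq⟩
        (ε * t ⟨q, hq⟩ + φ (extendZero t))) p
      rw [extendZero_coe] at this
      rw [this, ← extendZero_coe t ⟨q, hq⟩]
      rfl
    · rw [extendZero_update, hφq]

/-- Since each `φ q` sees only entries outside `A`, the simultaneous change equals the
one-coordinate changes performed one after another. -/
theorem piecewise [DecidableEq α] (A : Finset α) (hA : ↑A ⊆ S) {ε : α → ℝ}
    (hε : ∀ q, ε q = 1 ∨ ε q = -1) {φ : α → (α → ℝ) → ℝ} (hφ : ∀ q, Measurable (φ q))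
    (hφA : ∀ q ∈ A, ∀ u v : α → ℝ, (∀ p ∉ A, u p = v p) → φ q u = φ q v) :
    PreservesVolumeOn S fun u p => if p ∈ A then ε p * u p + φ p u else u p := by
  suffices h : ∀ B ⊆ A, PreservesVolumeOn S
      fun u p => if p ∈ B then ε p * u p + φ p u else u p from h A subset_rfl
  intro B
  induction B using Finset.induction_on with
  | empty => intro _; simpa using PreservesVolumeOn.id
  | insert q B hqB ih =>
    intro hB
    have hqA : q ∈ A := hB (Finset.mem_insert_self q B)
    have hBA : B ⊆ A := (Finset.subset_insert q B).trans hB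
    convert (PreservesVolumeOn.update (hA hqA) (hε q) (hφ q) (fun u v => ?_)).comp (ih hBA) using 1
    · funext u p
      have hloc : φ q (fun p => if p ∈ B then ε p * u p + φ p u else u p) = φ q u :=
        hφA q hqA _ _ fun p hp => if_neg fun h => hp (hBA h)
      rcases eq_or_ne p q with rfl | h
      · simp [hqB, hloc]
      · simp [h]
    · exact hφA q hqA _ _ fun p hp => Function.update_of_ne (ne_of_mem_of_not_mem hqA hp).symm _ _

theorem map_withDensity {T : (α → ℝ) → α → ℝ} (hT : PreservesVolumeOn S T)
    {f g : (α → ℝ) → ENNReal} (hg : Measurable g)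
    (h : ∀ u, (∀ p ∉ S, u p = 0) → g (T u) = f u) :
    (volume.withDensity fun t : S → ℝ => f (extendZero t)).map
        (fun t => S.domRestrict (T (extendZero t))) =
      volume.withDensity fun t => g (extendZero t) :=
  map_withDensity_comp hT.measurePreserving (hg.comp measurable_extendZero) fun t => by
    rw [hT.extendZero_apply, h _ fun _ => extendZero_of_notMem t]

end PreservesVolumeOn

/-! ### RSK and Burge local moves -/

/-- The maximum of the values at the two predecessors of a cell. -/
noncomputable def lo (u : ℕ × ℕ → ℝ) (p : ℕ × ℕ) : ℝ :=
  max (u (p.1 - 1, p.2)) (u (p.1, p.2 - 1))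

/-- The minimum of the values at the two successors of a cell. -/
noncomputable def hi (u : ℕ × ℕ → ℝ) (p : ℕ × ℕ) : ℝ :=
  min (u (p.1 + 1, p.2)) (u (p.1, p.2 + 1))

/-- The cells with positive coordinates on the antidiagonals `m`, `m - 2`, `m - 4`, …. -/
def flipCells (m : ℕ) : Finset (ℕ × ℕ) :=
  (Finset.range (m + 1) ×ˢ Finset.range (m + 1)).filter fun p =>
    1 ≤ p.1 ∧ 1 ≤ p.2 ∧ p.1 + p.2 ≤ m ∧ (p.1 + p.2) % 2 = m % 2

theorem mem_flipCells {m : ℕ} {p : ℕ × ℕ} : p ∈ flipCells m ↔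
    1 ≤ p.1 ∧ 1 ≤ p.2 ∧ p.1 + p.2 ≤ m ∧ (p.1 + p.2) % 2 = m % 2 := by
  simp only [flipCells, Finset.mem_filter, Finset.mem_product, Finset.mem_range]
  exact ⟨fun h => h.2, fun h => ⟨⟨by omega, by omega⟩, h⟩⟩

theorem mem_flipCells_mk {m i j : ℕ} : (i, j) ∈ flipCells m ↔
    1 ≤ i ∧ 1 ≤ j ∧ i + j ≤ m ∧ (i + j) % 2 = m % 2 := mem_flipCells

/-- The neighbours of a flipped cell have the opposite parity, so they are not flipped. This is what
makes simultaneous and successive moves agree. -/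
theorem lo_congr {m : ℕ} {u v : ℕ × ℕ → ℝ} (h : ∀ p ∉ flipCells m, u p = v p) {q : ℕ × ℕ}
    (hq : q ∈ flipCells m) : lo u q = lo v q := by
  rw [mem_flipCells] at hq
  rw [lo, lo, h, h] <;> rw [mem_flipCells] <;> dsimp only <;> omega

theorem hi_congr {m : ℕ} {u v : ℕ × ℕ → ℝ} (h : ∀ p ∉ flipCells m, u p = v p) {q : ℕ × ℕ}
    (hq : q ∈ flipCells m) : hi u q = hi v q := by
  rw [mem_flipCells] at hq
  rw [hi, hi, h, h] <;> rw [mem_flipCells] <;> dsimp only <;> omega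

@[fun_prop]
theorem measurable_lo (q : ℕ × ℕ) : Measurable fun u => lo u q := by
  unfold lo; fun_prop

@[fun_prop]
theorem measurable_hi (q : ℕ × ℕ) : Measurable fun u => hi u q := by
  unfold hi; fun_prop

/-- The simultaneous Robinson–Schensted–Knuth local moves along all diagonals ending on the
antidiagonal `m`: the entries of that antidiagonal are inserted and the entries on the earlier
antidiagonals of the same parity are toggled. -/
noncomputable def rskStep (m : ℕ) (u : ℕ × ℕ → ℝ) (p : ℕ × ℕ) : ℝ :=
  if p ∈ flipCells m then
    (if p.1 + p.2 = m then 1 else -1) * u p + (lo u p + if p.1 + p.2 = m then 0 else hi u p)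
  else u p

theorem rskStep_of_eq {m : ℕ} (u : ℕ × ℕ → ℝ) {p : ℕ × ℕ} (hp : p ∈ flipCells m)
    (h : p.1 + p.2 = m) : rskStep m u p = u p + lo u p := by
  simp [rskStep, hp, h]

theorem rskStep_of_ne {m : ℕ} (u : ℕ × ℕ → ℝ) {p : ℕ × ℕ} (hp : p ∈ flipCells m)
    (h : p.1 + p.2 ≠ m) : rskStep m u p = lo u p + hi u p - u p := by
  simp only [rskStep, hp, h, if_true, if_false]; ring

theorem rskStep_of_notMem {m : ℕ} (u : ℕ × ℕ → ℝ) {p : ℕ × ℕ} (hp : p ∉ flipCells m) :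
    rskStep m u p = u p := if_neg hp

/-- The amount exchanged by `burgeMove`. -/
noncomputable def burgeShift (p d : ℕ × ℕ) (u : ℕ × ℕ → ℝ) : ℝ :=
  hi u d - min (u d - lo u d) (u p) - u d

/-- The involution by which the Burge and the Robinson–Schensted–Knuth local moves differ: it moves
mass between the entry `p` being inserted and an earlier entry `d` on the same diagonal. -/
noncomputable def burgeMove (p d : ℕ × ℕ) (u : ℕ × ℕ → ℝ) (q : ℕ × ℕ) : ℝ :=
  u q + ((if q = p then burgeShift p d u else 0) + if q = d then burgeShift p d u else 0)

theorem burgeMove_of_ne {p d q : ℕ × ℕ} (u : ℕ × ℕ → ℝ) (hp : q ≠ p) (hd : q ≠ d) :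
    burgeMove p d u q = u q := by
  simp [burgeMove, hp, hd]

theorem burgeMove_left {p d : ℕ × ℕ} (u : ℕ × ℕ → ℝ) (h : p ≠ d) :
    burgeMove p d u p = u p + burgeShift p d u := by
  simp [burgeMove, h]

theorem burgeMove_right {p d : ℕ × ℕ} (u : ℕ × ℕ → ℝ) (h : p ≠ d) :
    burgeMove p d u d = hi u d - min (u d - lo u d) (u p) := by
  simp [burgeMove, h.symm, burgeShift]

theorem burgeMove_of_notMem {m : ℕ} {p d q : ℕ × ℕ} (u : ℕ × ℕ → ℝ) (hp : p ∈ flipCells m)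
    (hd : d ∈ flipCells m) (hq : q ∉ flipCells m) : burgeMove p d u q = u q :=
  burgeMove_of_ne u (ne_of_mem_of_not_mem hp hq).symm (ne_of_mem_of_not_mem hd hq).symm

/-- The move keeps `u p - u d`, `lo u d` and `hi u d`, hence the branch taken by the minimum; in
either branch the second shift is the negative of the first. -/
theorem burgeMove_burgeMove {m : ℕ} {p d : ℕ × ℕ} (u : ℕ × ℕ → ℝ) (hp : p ∈ flipCells m)
    (hd : d ∈ flipCells m) (hpd : p ≠ d) : burgeMove p d (burgeMove p d u) = u := by
  have hlo := lo_congr (fun q hq => burgeMove_of_notMem u hp hd hq) hd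
  have hhi := hi_congr (fun q hq => burgeMove_of_notMem u hp hd hq) hd
  have hs : burgeShift p d (burgeMove p d u) = -burgeShift p d u := by
    rw [burgeShift, hlo, hhi, burgeMove_left u hpd, burgeMove_right u hpd, burgeShift]
    rcases le_total (u d - lo u d) (u p) with h | h
    · rw [min_eq_left h, min_eq_left (by linarith)]; ring
    · rw [min_eq_right h, min_eq_right (by linarith)]; ring
  funext q
  rw [burgeMove, hs, burgeMove]
  split_ifs <;> ring

theorem coe_flipCells_subset {m n : ℕ} (hm : m ≤ n) : ↑(flipCells m) ⊆ staircase n := fun p hp => by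
  rw [Finset.mem_coe, mem_flipCells] at hp
  exact ⟨hp.1, hp.2.1, hp.2.2.1.trans hm⟩

section volume

variable {n : ℕ} [Fintype (staircase n)]

theorem preservesVolumeOn_rskStep {m : ℕ} (hm : m ≤ n) :
    PreservesVolumeOn (staircase n) (rskStep m) := by
  refine PreservesVolumeOn.piecewise (flipCells m) (coe_flipCells_subset hm)
    (ε := fun p => if p.1 + p.2 = m then 1 else -1)
    (φ := fun p u => lo u p + if p.1 + p.2 = m then 0 else hi u p) (fun q => ?_) (fun q => ?_)
    fun q hq u v h => ?_
  · split_ifs <;> simp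
  · split_ifs <;> fun_prop
  · rw [lo_congr h hq, hi_congr h hq]

theorem preservesVolumeOn_burgeMove {m : ℕ} (hm : m ≤ n) {p d : ℕ × ℕ} (hp : p ∈ flipCells m)
    (hd : d ∈ flipCells m) (hpd : p ≠ d) :
    PreservesVolumeOn (staircase n) (burgeMove p d) := by
  have hpS := coe_flipCells_subset hm hp
  have hdS := coe_flipCells_subset hm hd
  have hupd : ∀ (u : ℕ × ℕ → ℝ) (q : ℕ × ℕ) (v : ℝ), q ∈ flipCells m →
      ∀ r ∉ flipCells m, Function.update u q v r = u r := fun u q v hq r hr =>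
    Function.update_of_ne (ne_of_mem_of_not_mem hq hr).symm _ _
  -- In the coordinates `u p - u d` and `u d` only the second one changes, by a reflection depending
  -- on the rest. The move is this reflection conjugated by a shear.
  have h1 := PreservesVolumeOn.update hpS (Or.inl rfl : (1 : ℝ) = 1 ∨ (1 : ℝ) = -1)
    (φ := fun u => - u d) (by fun_prop) (fun u v => by rw [Function.update_of_ne hpd.symm])
  have h2 := PreservesVolumeOn.update hdS (Or.inr rfl : (-1 : ℝ) = 1 ∨ (-1 : ℝ) = -1)
    (φ := fun u => hi u d - min (-lo u d) (u p)) (by fun_prop) (fun u v => by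
      rw [lo_congr (hupd u d v hd) hd, hi_congr (hupd u d v hd) hd, Function.update_of_ne hpd])
  have h3 := PreservesVolumeOn.update hpS (Or.inl rfl : (1 : ℝ) = 1 ∨ (1 : ℝ) = -1)
    (φ := fun u => u d) (by fun_prop) (fun u v => by rw [Function.update_of_ne hpd.symm])
  convert h3.comp (h2.comp h1) using 1
  funext u q
  have hmin : min (-lo u d) (u p - u d) = min (u d - lo u d) (u p) - u d := by
    rw [← min_sub_sub_right]; congr 1; ring
  simp only [lo_congr (hupd u p _ hp) hd, hi_congr (hupd u p _ hp) hd]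
  rcases eq_or_ne q p with rfl | hqp
  · rw [burgeMove_left u hpd, burgeShift]
    simp [hpd, hpd.symm, ← sub_eq_add_neg, hmin]
    ring
  · rcases eq_or_ne q d with rfl | hqd
    · rw [burgeMove_right u hpd]
      simp [hqp, hqp.symm, ← sub_eq_add_neg, hmin]
      ring
    · rw [burgeMove_of_ne u hqp hqd]
      simp [hqp, hqd]

end volume

/-! ### Interlacing -/

/-- Nonnegative functions that are monotone in both coordinates on the antidiagonals up to `m`. -/
structure Interlaced (m : ℕ) (u : ℕ × ℕ → ℝ) : Prop where
  nonneg : ∀ p, 0 ≤ u p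
  le_right : ∀ i j, i + j + 1 ≤ m → u (i, j) ≤ u (i + 1, j)
  le_up : ∀ i j, i + j + 1 ≤ m → u (i, j) ≤ u (i, j + 1)

section Interlaced

variable {m : ℕ} {u : ℕ × ℕ → ℝ}

theorem Interlaced.lo_le (h : Interlaced m u) {q : ℕ × ℕ} (h1 : 1 ≤ q.1) (h2 : 1 ≤ q.2)
    (hq : q.1 + q.2 ≤ m) : lo u q ≤ u q := by
  obtain ⟨i, j⟩ := q
  obtain ⟨i, rfl⟩ := Nat.exists_eq_add_of_le' h1
  obtain ⟨j, rfl⟩ := Nat.exists_eq_add_of_le' h2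
  exact max_le (h.le_right _ _ (by simpa [add_assoc, add_comm, add_left_comm] using hq))
    (h.le_up _ _ (by simpa [add_assoc, add_comm, add_left_comm] using hq))

theorem Interlaced.le_hi (h : Interlaced m u) {q : ℕ × ℕ} (hq : q.1 + q.2 + 1 ≤ m) :
    u q ≤ hi u q :=
  le_min (h.le_right _ _ hq) (h.le_up _ _ hq)

theorem lo_nonneg (h : ∀ p, 0 ≤ u p) (q : ℕ × ℕ) : 0 ≤ lo u q := le_max_of_le_left (h _)

/-- Every edge of the lattice has exactly one end of the parity of `m`, so it suffices to compare
these cells with their neighbours. Edges starting on an axis only need nonnegativity. -/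
theorem Interlaced.of_flipCells
    (hu : ∀ p : ℕ × ℕ, p.1 = 0 ∨ p.2 = 0 → u p = 0) {l : ℕ} (hl : l ≤ m) (h0 : ∀ p, 0 ≤ u p)
    (hlo : ∀ q ∈ flipCells m, q.1 + q.2 ≤ l → lo u q ≤ u q)
    (hhi : ∀ q ∈ flipCells m, q.1 + q.2 + 1 ≤ l → u q ≤ hi u q) : Interlaced l u := by
  have key : ∀ i j, i + j + 1 ≤ l → u (i, j) ≤ u (i + 1, j) ∧ u (i, j) ≤ u (i, j + 1) := by
    intro i j hij
    by_cases h1 : i = 0 ∨ j = 0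
    · rw [hu (i, j) h1]; exact ⟨h0 _, h0 _⟩
    by_cases h2 : (i + j) % 2 = m % 2
    · have := hhi (i, j) (mem_flipCells_mk.2 (by omega)) hij
      exact le_min_iff.1 this
    · exact ⟨(le_max_left _ _).trans (hlo (i + 1, j) (mem_flipCells_mk.2 (by omega))
        (by dsimp only; omega)), (le_max_right _ _).trans (hlo (i, j + 1)
        (mem_flipCells_mk.2 (by omega)) (by dsimp only; omega))⟩
  exact ⟨h0, fun i j h => (key i j h).1, fun i j h => (key i j h).2⟩

/-- A toggle reflects the interval from `lo` to `hi` onto itself. On the new antidiagonal, being at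
least `lo` after insertion means that the inserted weight was nonnegative. -/
theorem interlaced_rskStep_iff
    (hu : ∀ p : ℕ × ℕ, p.1 = 0 ∨ p.2 = 0 → u p = 0) (hm : 1 ≤ m) :
    Interlaced m (rskStep m u) ↔ Interlaced (m - 1) u := by
  have hlo : ∀ q ∈ flipCells m, lo (rskStep m u) q = lo u q := fun q =>
    lo_congr fun p hp => rskStep_of_notMem u hp
  have hhi : ∀ q ∈ flipCells m, hi (rskStep m u) q = hi u q := fun q =>
    hi_congr fun p hp => rskStep_of_notMem u hp
  have hu' : ∀ p : ℕ × ℕ, p.1 = 0 ∨ p.2 = 0 → rskStep m u p = 0 := fun p hp => by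
    rw [rskStep_of_notMem u (by rw [mem_flipCells]; omega), hu p hp]
  constructor
  · intro h
    have hl : ∀ q ∈ flipCells m, lo u q ≤ rskStep m u q := fun q hq => by
      have hq' := mem_flipCells.1 hq
      rw [← hlo q hq]; exact h.lo_le hq'.1 hq'.2.1 hq'.2.2.1
    have hh : ∀ q ∈ flipCells m, q.1 + q.2 ≠ m → rskStep m u q ≤ hi u q := fun q hq hne => by
      have hq' := mem_flipCells.1 hq
      rw [← hhi q hq]; exact h.le_hi (by omega)
    have hl0 : ∀ q ∈ flipCells m, 0 ≤ lo u q := fun q hq => by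
      rw [← hlo q hq]; exact lo_nonneg h.nonneg q
    refine .of_flipCells hu (Nat.sub_le m 1) (fun p => ?_) (fun q hq hs => ?_) fun q hq hs => ?_
    · by_cases hp : p ∈ flipCells m
      · have h1 := hl p hp
        by_cases hs : p.1 + p.2 = m
        · rw [rskStep_of_eq u hp hs] at h1; linarith
        · have h2 := hh p hp hs
          rw [rskStep_of_ne u hp hs] at h2
          linarith [hl0 p hp]
      · rw [← rskStep_of_notMem u hp]; exact h.nonneg p
    · have h2 := hh q hq (by omega)
      rw [rskStep_of_ne u hq (by omega)] at h2
      linarith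
    · have h2 := hl q hq
      rw [rskStep_of_ne u hq (by omega)] at h2
      linarith
  · intro h
    have hl : ∀ q ∈ flipCells m, lo u q ≤ rskStep m u q := fun q hq => by
      have hq' := mem_flipCells.1 hq
      by_cases hs : q.1 + q.2 = m
      · rw [rskStep_of_eq u hq hs]; linarith [h.nonneg q]
      · rw [rskStep_of_ne u hq hs]
        linarith [h.le_hi (q := q) (by omega)]
    refine .of_flipCells hu' le_rfl (fun p => ?_) (fun q hq hs => ?_) fun q hq hs => ?_
    · by_cases hp : p ∈ flipCells m
      · exact (lo_nonneg h.nonneg p).trans (hl p hp)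
      · rw [rskStep_of_notMem u hp]; exact h.nonneg p
    · rw [hlo q hq]; exact hl q hq
    · have hq' := mem_flipCells.1 hq
      rw [hhi q hq, rskStep_of_ne u hq (by omega)]
      linarith [h.lo_le hq'.1 hq'.2.1 (by omega)]

/-- The minimum lies between 0 and `u d - lo u d`, so the new value at `d` lies between `lo` and
`hi`. The cell `p` lies beyond the antidiagonal `m`, so there only the sign matters: the minimum is
at most `u p`, and `u d ≤ hi u d`. -/
theorem Interlaced.burgeMove
    (hu : ∀ p : ℕ × ℕ, p.1 = 0 ∨ p.2 = 0 → u p = 0) (h : Interlaced m u) {p d : ℕ × ℕ} (hp : p ∈ flipCells (m + 1))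
    (hd : d ∈ flipCells (m + 1)) (hps : p.1 + p.2 = m + 1) (hds : d.1 + d.2 ≠ m + 1) :
    Interlaced m (burgeMove p d u) := by
  have hpd : p ≠ d := by rintro rfl; exact hds hps
  have hlo := fun q => lo_congr (fun q hq => burgeMove_of_notMem u hp hd hq) (q := q)
  have hhi := fun q => hi_congr (fun q hq => burgeMove_of_notMem u hp hd hq) (q := q)
  have hd' := mem_flipCells.1 hd
  have h1 : lo u d ≤ u d := h.lo_le hd'.1 hd'.2.1 (by omega)
  have h2 : u d ≤ hi u d := h.le_hi (by omega)
  have hmin := min_le_left (u d - lo u d) (u p)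
  have hmin' : 0 ≤ min (u d - lo u d) (u p) := le_min (by linarith) (h.nonneg p)
  refine .of_flipCells (fun q hq => ?_) (Nat.le_succ m) (fun q => ?_) (fun q hq hs => ?_)
    fun q hq hs => ?_
  · rw [burgeMove_of_notMem u hp hd (by rw [mem_flipCells]; omega), hu q hq]
  · rcases eq_or_ne q p with rfl | hqp
    · rw [burgeMove_left u hpd, burgeShift]
      linarith [min_le_right (u d - lo u d) (u q)]
    · rcases eq_or_ne q d with rfl | hqd
      · rw [burgeMove_right u hpd]; linarith [lo_nonneg h.nonneg q]
      · rw [burgeMove_of_ne u hqp hqd]; exact h.nonneg q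
  · have hq' := mem_flipCells.1 hq
    have hqp : q ≠ p := by rintro rfl; omega
    rw [hlo q hq]
    rcases eq_or_ne q d with rfl | hqd
    · rw [burgeMove_right u hpd]; linarith
    · rw [burgeMove_of_ne u hqp hqd]; exact h.lo_le hq'.1 hq'.2.1 hs
  · have hqp : q ≠ p := by rintro rfl; omega
    rw [hhi q hq]
    rcases eq_or_ne q d with rfl | hqd
    · rw [burgeMove_right u hpd]; linarith
    · rw [burgeMove_of_ne u hqp hqd]; exact h.le_hi hs

theorem interlaced_burgeMove_iff
    (hu : ∀ p : ℕ × ℕ, p.1 = 0 ∨ p.2 = 0 → u p = 0) {p d : ℕ × ℕ} (hp : p ∈ flipCells (m + 1))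
    (hd : d ∈ flipCells (m + 1)) (hps : p.1 + p.2 = m + 1) (hds : d.1 + d.2 ≠ m + 1) :
    Interlaced m (burgeMove p d u) ↔ Interlaced m u := by
  refine ⟨fun h => ?_, fun h => h.burgeMove hu hp hd hps hds⟩
  have h' := h.burgeMove (fun q hq => ?_) hp hd hps hds
  · rwa [burgeMove_burgeMove u hp hd (by rintro rfl; exact hds hps)] at h'
  · rw [burgeMove_of_notMem u hp hd (by rw [mem_flipCells]; omega), hu q hq]

end Interlaced

/-! ### Conservation of energy -/

/-- The sum of the values on the antidiagonal `s`. -/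
noncomputable def antidiagonalSum (u : ℕ × ℕ → ℝ) (s : ℕ) : ℝ :=
  ∑ p ∈ Finset.HasAntidiagonal.antidiagonal s, u p

/-- The alternating sum `f (m - 1) - f (m - 2) + f (m - 3) - ⋯`. -/
noncomputable def altSum (f : ℕ → ℝ) (m : ℕ) : ℝ :=
  ∑ s ∈ Finset.range m, (-1) ^ (m + 1 + s) * f s

theorem altSum_zero (f : ℕ → ℝ) : altSum f 0 = 0 := by simp [altSum]

theorem altSum_succ (f : ℕ → ℝ) (m : ℕ) : altSum f (m + 1) = f m - altSum f m := by
  have h : (-1 : ℝ) ^ (m + 1 + 1 + m) = 1 := Even.neg_one_pow ⟨m + 1, by ring⟩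
  rw [altSum, Finset.sum_range_succ, h, altSum, one_mul, add_comm, sub_eq_add_neg,
    ← Finset.sum_neg_distrib]
  congr 1
  exact Finset.sum_congr rfl fun s _ => by ring

theorem altSum_congr {f g : ℕ → ℝ} {m : ℕ} (h : ∀ s < m, f s = g s) : altSum f m = altSum g m :=
  Finset.sum_congr rfl fun s hs => by rw [h s (Finset.mem_range.1 hs)]

/-- The energy of a state in which the antidiagonals up to `m` have been processed: in terms of the
weights that produced the state, it is their sum. -/
noncomputable def energy (n m : ℕ) (u : ℕ × ℕ → ℝ) : ℝ :=
  altSum (antidiagonalSum u) (m + 1) + ∑ s ∈ Finset.Ioc m n, antidiagonalSum u s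

section energy

variable {m n : ℕ} {u : ℕ × ℕ → ℝ}

theorem antidiagonalSum_burgeMove (p d : ℕ × ℕ) (s : ℕ) :
    antidiagonalSum (burgeMove p d u) s = antidiagonalSum u s +
      ((if s = p.1 + p.2 then burgeShift p d u else 0) +
        if s = d.1 + d.2 then burgeShift p d u else 0) := by
  simp only [antidiagonalSum, burgeMove, Finset.sum_add_distrib, Finset.sum_ite_eq',
    Finset.HasAntidiagonal.mem_antidiagonal]
  simp only [eq_comm]

/-- Both entries gain the same amount, but `p` is counted with sign + as an unprocessed weight and
`d`, by parity, with sign -. -/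
theorem energy_burgeMove {p d : ℕ × ℕ} (hps : p.1 + p.2 = m + 1) (hmn : m + 1 ≤ n)
    (hds : d.1 + d.2 ≤ m) (hpar : (d.1 + d.2) % 2 = (m + 1) % 2) :
    energy n m (burgeMove p d u) = energy n m u := by
  have hsign : (-1 : ℝ) ^ (m + 1 + 1 + (d.1 + d.2)) = -1 := Odd.neg_one_pow (by
    rw [Nat.odd_iff]; omega)
  have h1 : m + 1 ∈ Finset.Ioc m n := by simp; omega
  have h2 : d.1 + d.2 ∉ Finset.Ioc m n := by simp; omega
  have h3 : d.1 + d.2 ∈ Finset.range (m + 1) := by simp; omega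
  simp only [energy, altSum, antidiagonalSum_burgeMove, hps, mul_add, Finset.sum_add_distrib,
    mul_ite, mul_zero, Finset.sum_ite_eq', h1, h2, h3, if_true, if_false, hsign,
    Finset.mem_range, lt_irrefl]
  ring

theorem antidiagonalSum_rskStep_of_ne {s : ℕ} (h : ¬(s ≤ m ∧ s % 2 = m % 2)) :
    antidiagonalSum (rskStep m u) s = antidiagonalSum u s := by
  refine Finset.sum_congr rfl fun p hp => rskStep_of_notMem u ?_
  rw [Finset.HasAntidiagonal.mem_antidiagonal] at hp
  rw [mem_flipCells]
  omega

theorem lo_eq_zero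
    (hu : ∀ p : ℕ × ℕ, p.1 = 0 ∨ p.2 = 0 → u p = 0) {p : ℕ × ℕ} (hp : p.1 = 0 ∨ p.2 = 0) : lo u p = 0 := by
  rw [lo, hu, hu, max_self] <;> dsimp only <;> omega

theorem hi_eq_zero (hu : ∀ p : ℕ × ℕ, p.1 = 0 ∨ p.2 = 0 → u p = 0)
    (h0 : ∀ p, 0 ≤ u p) {p : ℕ × ℕ} (hp : p.1 = 0 ∨ p.2 = 0) : hi u p = 0 := by
  rcases hp with hp | hp
  · rw [hi, hu (p.1, p.2 + 1) (Or.inl hp)]; exact min_eq_right (h0 _)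
  · rw [hi, hu (p.1 + 1, p.2) (Or.inr hp)]; exact min_eq_left (h0 _)

theorem antidiagonalSum_rskStep_self
    (hu : ∀ p : ℕ × ℕ, p.1 = 0 ∨ p.2 = 0 → u p = 0) :
    antidiagonalSum (rskStep m u) m = antidiagonalSum u m + antidiagonalSum (lo u) m := by
  rw [antidiagonalSum, antidiagonalSum, antidiagonalSum, ← Finset.sum_add_distrib]
  refine Finset.sum_congr rfl fun p hp => ?_
  rw [Finset.HasAntidiagonal.mem_antidiagonal] at hp
  by_cases h : p.1 = 0 ∨ p.2 = 0
  · rw [rskStep_of_notMem u (by rw [mem_flipCells]; omega), lo_eq_zero hu h, add_zero]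
  · rw [rskStep_of_eq u (by rw [mem_flipCells]; omega) hp]

theorem antidiagonalSum_rskStep_of_lt (hu : ∀ p : ℕ × ℕ, p.1 = 0 ∨ p.2 = 0 → u p = 0)
    (h0 : ∀ p, 0 ≤ u p) {s : ℕ} (hs : s < m) (hpar : s % 2 = m % 2) :
    antidiagonalSum (rskStep m u) s =
      antidiagonalSum (lo u) s + antidiagonalSum (hi u) s - antidiagonalSum u s := by
  rw [antidiagonalSum, antidiagonalSum, antidiagonalSum, antidiagonalSum,
    ← Finset.sum_add_distrib, ← Finset.sum_sub_distrib]
  refine Finset.sum_congr rfl fun p hp => ?_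
  rw [Finset.HasAntidiagonal.mem_antidiagonal] at hp
  by_cases h : p.1 = 0 ∨ p.2 = 0
  · rw [rskStep_of_notMem u (by rw [mem_flipCells]; omega), lo_eq_zero hu h,
      hi_eq_zero hu h0 h, hu p h]
    ring
  · rw [rskStep_of_ne u (by rw [mem_flipCells]; omega) (by omega)]

/-- `hi` at (i, j) and `lo` at (i + 1, j + 1) are the minimum and the maximum of the same two
entries, whose sum is thus conserved. -/
theorem antidiagonalSum_hi_add_lo
    (hu : ∀ p : ℕ × ℕ, p.1 = 0 ∨ p.2 = 0 → u p = 0) (s : ℕ) :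
    antidiagonalSum (hi u) s + antidiagonalSum (lo u) (s + 2) = 2 * antidiagonalSum u (s + 1) := by
  have h1 : antidiagonalSum (lo u) (s + 2) =
      ∑ p ∈ Finset.HasAntidiagonal.antidiagonal s, lo u (p.1 + 1, p.2 + 1) := by
    rw [antidiagonalSum, Finset.Nat.antidiagonal_succ_succ']
    simp [lo_eq_zero hu, Prod.map]
  have h2 : antidiagonalSum u (s + 1) = ∑ p ∈ Finset.HasAntidiagonal.antidiagonal s, u (p.1 + 1, p.2) := by
    rw [antidiagonalSum, Finset.Nat.antidiagonal_succ]
    simp [hu, Prod.map]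
  have h3 : antidiagonalSum u (s + 1) = ∑ p ∈ Finset.HasAntidiagonal.antidiagonal s, u (p.1, p.2 + 1) := by
    rw [antidiagonalSum, Finset.Nat.antidiagonal_succ']
    simp [hu, Prod.map]
  rw [two_mul]
  nth_rewrite 1 [h2]
  rw [h3, h1, antidiagonalSum, ← Finset.sum_add_distrib, ← Finset.sum_add_distrib]
  refine Finset.sum_congr rfl fun p _ => ?_
  rw [hi, lo, max_comm]
  exact min_add_max _ _

/-- The induction goes by steps of two because `rskStep (m + 2)` and `rskStep m` agree on the
antidiagonals below `m`. The `lo` and `hi` terms of successive toggled antidiagonals then telescope.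
-/
theorem altSum_rskStep (hu : ∀ p : ℕ × ℕ, p.1 = 0 ∨ p.2 = 0 → u p = 0)
    (h0 : ∀ p, 0 ≤ u p) (m : ℕ) : altSum (antidiagonalSum (rskStep m u)) m =
    antidiagonalSum (lo u) m - altSum (antidiagonalSum u) m := by
  induction m using Nat.twoStepInduction with
  | zero => simp [altSum_zero, antidiagonalSum, lo_eq_zero hu]
  | one =>
    have : antidiagonalSum (lo u) 1 = 0 := by
      simp [antidiagonalSum, Finset.Nat.antidiagonal_succ, lo_eq_zero hu]
    rw [altSum_succ, altSum_succ, altSum_zero, altSum_zero, this,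
      antidiagonalSum_rskStep_of_ne (by omega)]
    simp [antidiagonalSum, hu]
  | more m ih _ =>
    have hlow : altSum (antidiagonalSum (rskStep (m + 2) u)) m =
        altSum (antidiagonalSum (rskStep m u)) m := altSum_congr fun s hs => by
      by_cases hpar : s % 2 = m % 2
      · rw [antidiagonalSum_rskStep_of_lt hu h0 hs hpar,
          antidiagonalSum_rskStep_of_lt hu h0 (by omega) (by omega)]
      · rw [antidiagonalSum_rskStep_of_ne (by omega), antidiagonalSum_rskStep_of_ne (by omega)]
    rw [altSum_succ, altSum_succ, altSum_succ, altSum_succ, hlow, ih,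
      antidiagonalSum_rskStep_of_ne (by omega),
      antidiagonalSum_rskStep_of_lt hu h0 (by omega) (by omega)]
    linarith [antidiagonalSum_hi_add_lo hu m]

theorem energy_rskStep (hu : ∀ p : ℕ × ℕ, p.1 = 0 ∨ p.2 = 0 → u p = 0)
    (h0 : ∀ p, 0 ≤ u p) (hmn : m + 1 ≤ n) :
    energy n (m + 1) (rskStep (m + 1) u) = energy n m u := by
  have hI : Finset.Ioc m n = insert (m + 1) (Finset.Ioc (m + 1) n) := by
    ext; simp; omega
  have htail : ∑ s ∈ Finset.Ioc (m + 1) n, antidiagonalSum (rskStep (m + 1) u) s =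
      ∑ s ∈ Finset.Ioc (m + 1) n, antidiagonalSum u s :=
    Finset.sum_congr rfl fun s hs => antidiagonalSum_rskStep_of_ne (by
      rw [Finset.mem_Ioc] at hs; omega)
  rw [energy, energy, hI, Finset.sum_insert (by simp), htail, altSum_succ, altSum_rskStep hu h0,
    antidiagonalSum_rskStep_self hu]
  ring

end energy

/-! ### The density carried along by the moves -/

open Classical in
/-- The density of the state in which the antidiagonals up to `m` have been processed. -/
noncomputable def weight (n m : ℕ) (u : ℕ × ℕ → ℝ) : ENNReal :=
  if Interlaced m u then ENNReal.ofReal (Real.exp (-energy n m u)) else 0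

theorem measurable_weight (n m : ℕ) : Measurable (weight n m) := by
  classical
  have h : {u | Interlaced m u} = (⋂ p : ℕ × ℕ, {u | 0 ≤ u p}) ∩
      ((⋂ (i : ℕ) (j : ℕ) (_ : i + j + 1 ≤ m), {u : ℕ × ℕ → ℝ | u (i, j) ≤ u (i + 1, j)}) ∩
      ⋂ (i : ℕ) (j : ℕ) (_ : i + j + 1 ≤ m), {u : ℕ × ℕ → ℝ | u (i, j) ≤ u (i, j + 1)}) := by
    ext u
    simp only [Set.mem_inter_iff, Set.mem_iInter, Set.mem_ofPred_eq]
    exact ⟨fun h => ⟨h.1, h.2, h.3⟩, fun h => ⟨h.1, h.2.1, h.2.2⟩⟩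
  have hle : ∀ p q : ℕ × ℕ, MeasurableSet {u : ℕ × ℕ → ℝ | u p ≤ u q} := fun p q =>
    measurableSet_le (measurable_pi_apply p) (measurable_pi_apply q)
  refine Measurable.ite ?_ ?_ measurable_const
  · rw [h]
    exact (MeasurableSet.iInter fun p => measurableSet_le measurable_const
      (measurable_pi_apply p)).inter ((MeasurableSet.iInter fun i => .iInter fun j => .iInter
      fun _ => hle _ _).inter (MeasurableSet.iInter fun i => .iInter fun j => .iInter
      fun _ => hle _ _))
  · unfold energy altSum antidiagonalSum
    fun_prop

theorem weight_rskStep {m n : ℕ} {u : ℕ × ℕ → ℝ}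
    (hu : ∀ p : ℕ × ℕ, p.1 = 0 ∨ p.2 = 0 → u p = 0) (hmn : m + 1 ≤ n) :
    weight n (m + 1) (rskStep (m + 1) u) = weight n m u := by
  have h := interlaced_rskStep_iff hu (m := m + 1) (by omega)
  rw [Nat.add_sub_cancel] at h
  by_cases hi : Interlaced m u
  · rw [weight, weight, if_pos hi, if_pos (h.2 hi), energy_rskStep hu hi.nonneg hmn]
  · rw [weight, weight, if_neg hi, if_neg (h.not.2 hi)]

theorem weight_burgeMove {m n : ℕ} {u : ℕ × ℕ → ℝ}
    (hu : ∀ p : ℕ × ℕ, p.1 = 0 ∨ p.2 = 0 → u p = 0) (hmn : m + 1 ≤ n) {p d : ℕ × ℕ}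
    (hp : p ∈ flipCells (m + 1)) (hd : d ∈ flipCells (m + 1)) (hps : p.1 + p.2 = m + 1)
    (hds : d.1 + d.2 ≠ m + 1) : weight n m (burgeMove p d u) = weight n m u := by
  have hd' := mem_flipCells.1 hd
  rw [weight, weight, energy_burgeMove hps hmn (by omega) hd'.2.2.2,
    interlaced_burgeMove_iff hu hp hd hps hds]

/-! ### The two insertion schemes -/

/-- The state reached from the weights `X` by inserting the antidiagonals up to `m` with the
Robinson–Schensted–Knuth local moves. -/
noncomputable def rskChain (X : ℕ × ℕ → ℝ) : ℕ → ℕ × ℕ → ℝ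
  | 0 => X
  | m + 1 => rskStep (m + 1) (rskChain X m)

/-- The composition of the moves `burgeMove p (p - (l, l))` for `l = k, k - 1, …, 1`. -/
noncomputable def burgeDiagonal (p : ℕ × ℕ) : ℕ → (ℕ × ℕ → ℝ) → ℕ × ℕ → ℝ
  | 0, u => u
  | k + 1, u => burgeDiagonal p k (burgeMove p (p.1 - (k + 1), p.2 - (k + 1)) u)

/-- The composition of the Burge moves along the diagonals that end at the first `a` cells
`(1, m - 1)`, `(2, m - 2)`, … of the antidiagonal `m`. -/
noncomputable def burgeAntidiagonal (m : ℕ) : ℕ → (ℕ × ℕ → ℝ) → ℕ × ℕ → ℝ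
  | 0, u => u
  | a + 1, u => burgeDiagonal (a + 1, m - (a + 1)) (min (a + 1) (m - (a + 1)) - 1)
      (burgeAntidiagonal m a u)

/-- The state reached from the weights `X` by inserting the antidiagonals up to `m` with the Burge
local moves. -/
noncomputable def burgeChain (X : ℕ × ℕ → ℝ) : ℕ → ℕ × ℕ → ℝ
  | 0 => X
  | m + 1 => rskStep (m + 1) (burgeAntidiagonal (m + 1) m (burgeChain X m))

section invariant

variable {m : ℕ} {u X : ℕ × ℕ → ℝ}

theorem flipCells_of_diagonal {p : ℕ × ℕ} (hp : p.1 + p.2 = m) {k : ℕ} (hk1 : k < p.1)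
    (hk2 : k < p.2) : (p.1 - k, p.2 - k) ∈ flipCells m :=
  mem_flipCells_mk.2 (by omega)

/-- A relation between states that holds between `u` and each of its images under a Burge move along
the diagonals ending on the antidiagonal `m` holds along the whole composition. -/
theorem burgeAntidiagonal_induction {C : ((ℕ × ℕ → ℝ) → ℕ × ℕ → ℝ) → Prop} (hid : C fun u => u)
    (hcomp : ∀ T U, C T → C U → C fun u => T (U u))
    (hmove : ∀ p d, p ∈ flipCells m → d ∈ flipCells m → p.1 + p.2 = m → d.1 + d.2 ≠ m →
      C (burgeMove p d)) {a : ℕ} (ha : a < m ∨ a = 0) : C (burgeAntidiagonal m a) := by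
  have hdiag : ∀ (p : ℕ × ℕ), p.1 + p.2 = m → ∀ k, (k = 0 ∨ k < p.1 ∧ k < p.2) →
      C (burgeDiagonal p k) := by
    intro p hp k
    induction k with
    | zero => intro _; exact hid
    | succ k ih =>
      intro hk
      refine hcomp (burgeDiagonal p k) (burgeMove p _) (ih (by omega)) (hmove _ _ ?_ ?_ hp ?_)
      · rw [mem_flipCells]; omega
      · exact flipCells_of_diagonal hp (by omega) (by omega)
      · dsimp only; omega
  induction a with
  | zero => exact hid
  | succ a ih =>
    exact hcomp (burgeDiagonal _ _) (burgeAntidiagonal m a)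
      (hdiag (a + 1, m - (a + 1)) (by omega) _ (by omega)) (ih (by omega))

theorem burgeAntidiagonal_of_notMem {a : ℕ} (ha : a < m ∨ a = 0) {q : ℕ × ℕ}
    (hq : q ∉ flipCells m) : burgeAntidiagonal m a u q = u q := by
  refine burgeAntidiagonal_induction (C := fun T => ∀ u, T u q = u q) (fun _ => rfl)
    (fun T U hT hU u => (hT _).trans (hU u)) (fun p d hp hd _ _ u => ?_) ha u
  exact burgeMove_of_notMem u hp hd hq

theorem burgeChain_succ_of_notMem {q : ℕ × ℕ} (hq : q ∉ flipCells (m + 1)) :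
    burgeChain X (m + 1) q = burgeChain X m q := by
  rw [burgeChain, rskStep_of_notMem _ hq, burgeAntidiagonal_of_notMem (Or.inl m.lt_succ_self) hq]

theorem burgeChain_of_lt {q : ℕ × ℕ} (hq : m < q.1 + q.2) : burgeChain X m q = X q := by
  induction m with
  | zero => rfl
  | succ m ih => rw [burgeChain_succ_of_notMem (by rw [mem_flipCells]; omega), ih (by omega)]

theorem rskChain_of_lt {q : ℕ × ℕ} (hq : m < q.1 + q.2) : rskChain X m q = X q := by
  induction m with
  | zero => rfl
  | succ m ih =>
    rw [rskChain, rskStep_of_notMem _ (by rw [mem_flipCells]; omega), ih (by omega)]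

theorem burgeChain_eq_zero (hX : ∀ p : ℕ × ℕ, p.1 = 0 ∨ p.2 = 0 → X p = 0) (m : ℕ) {p : ℕ × ℕ}
    (hp : p.1 = 0 ∨ p.2 = 0) : burgeChain X m p = 0 := by
  induction m with
  | zero => exact hX p hp
  | succ m ih => rw [burgeChain_succ_of_notMem (by rw [mem_flipCells]; omega), ih]

theorem rskChain_eq_zero (hX : ∀ p : ℕ × ℕ, p.1 = 0 ∨ p.2 = 0 → X p = 0) (m : ℕ) {p : ℕ × ℕ}
    (hp : p.1 = 0 ∨ p.2 = 0) : rskChain X m p = 0 := by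
  induction m with
  | zero => exact hX p hp
  | succ m ih => rw [rskChain, rskStep_of_notMem _ (by rw [mem_flipCells]; omega), ih]

theorem burgeAntidiagonal_zero_and {D : (ℕ × ℕ → ℝ) → Prop}
    (hmove : ∀ u, (∀ p : ℕ × ℕ, p.1 = 0 ∨ p.2 = 0 → u p = 0) → D u → ∀ p d, p ∈ flipCells m →
      d ∈ flipCells m → p.1 + p.2 = m → d.1 + d.2 ≠ m → D (burgeMove p d u))
    (hu : ∀ p : ℕ × ℕ, p.1 = 0 ∨ p.2 = 0 → u p = 0) (h : D u) {a : ℕ} (ha : a < m ∨ a = 0) :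
    D (burgeAntidiagonal m a u) :=
  (burgeAntidiagonal_induction (C := fun T => ∀ u : ℕ × ℕ → ℝ,
      ((∀ p : ℕ × ℕ, p.1 = 0 ∨ p.2 = 0 → u p = 0) ∧ D u) →
      ((∀ p : ℕ × ℕ, p.1 = 0 ∨ p.2 = 0 → T u p = 0) ∧ D (T u))) (fun _ h => h)
    (fun _ U hT hU u h => hT (U u) (hU u h)) (fun p d hp hd hps hds u h =>
      ⟨fun q hq => by
        rw [burgeMove_of_notMem u hp hd (by rw [mem_flipCells]; omega), h.1 q hq],
        hmove u h.1 h.2 p d hp hd hps hds⟩) ha u ⟨hu, h⟩).2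

theorem interlaced_burgeChain (hX : ∀ p : ℕ × ℕ, p.1 = 0 ∨ p.2 = 0 → X p = 0)
    (h0 : ∀ p, 0 ≤ X p) (m : ℕ) : Interlaced m (burgeChain X m) := by
  induction m with
  | zero => exact ⟨h0, fun _ _ h => by omega, fun _ _ h => by omega⟩
  | succ m ih =>
    have hz := fun p hp => burgeChain_eq_zero hX m (p := p) hp
    rw [burgeChain, interlaced_rskStep_iff _ (by omega), Nat.add_sub_cancel]
    · exact burgeAntidiagonal_zero_and (D := Interlaced m) (fun u hu h p d hp hd hps hds =>
        h.burgeMove hu hp hd hps hds) hz ih (Or.inl m.lt_succ_self)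
    · intro p hp
      rw [burgeAntidiagonal_of_notMem (Or.inl m.lt_succ_self) (by rw [mem_flipCells]; omega), hz p hp]

theorem weight_burgeChain (hX : ∀ p : ℕ × ℕ, p.1 = 0 ∨ p.2 = 0 → X p = 0) {n : ℕ} (hmn : m ≤ n) :
    weight n m (burgeChain X m) = weight n 0 X := by
  induction m with
  | zero => rfl
  | succ m ih =>
    have hz := fun p hp => burgeChain_eq_zero hX m (p := p) hp
    rw [burgeChain, weight_rskStep _ hmn]
    · exact burgeAntidiagonal_zero_and (D := fun u => weight n m u = weight n 0 X)
        (fun u hu h p d hp hd hps hds => (weight_burgeMove hu hmn hp hd hps hds).trans h) hz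
        (ih (by omega)) (Or.inl m.lt_succ_self)
    · intro p hp
      rw [burgeAntidiagonal_of_notMem (Or.inl m.lt_succ_self) (by rw [mem_flipCells]; omega), hz p hp]

theorem weight_rskChain (hX : ∀ p : ℕ × ℕ, p.1 = 0 ∨ p.2 = 0 → X p = 0) {n : ℕ} (hmn : m ≤ n) :
    weight n m (rskChain X m) = weight n 0 X := by
  induction m with
  | zero => rfl
  | succ m ih =>
    rw [rskChain, weight_rskStep (fun p hp => rskChain_eq_zero hX m hp) hmn, ih (by omega)]

end invariant

section volume

variable {m n : ℕ} [Fintype (staircase n)]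

theorem preservesVolumeOn_rskChain (hm : m ≤ n) :
    PreservesVolumeOn (staircase n) fun X => rskChain X m := by
  induction m with
  | zero => exact .id
  | succ m ih => exact (preservesVolumeOn_rskStep hm).comp (ih (by omega))

theorem preservesVolumeOn_burgeChain (hm : m ≤ n) :
    PreservesVolumeOn (staircase n) fun X => burgeChain X m := by
  induction m with
  | zero => exact .id
  | succ m ih =>
    refine (preservesVolumeOn_rskStep hm).comp (.comp ?_ (ih (by omega)))
    exact burgeAntidiagonal_induction (C := PreservesVolumeOn (staircase n)) .id
      (fun _ _ hT hU => hT.comp hU) (fun p d hp hd hps hds =>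
        preservesVolumeOn_burgeMove hm hp hd (by rintro rfl; exact hds hps))
      (Or.inl m.lt_succ_self)

/-- For weights with density `weight n 0`, i.e. independent exponential weights, the final states of
the two insertion schemes have the same law. -/
theorem map_rskChain_eq_map_burgeChain :
    ((volume.withDensity fun t : staircase n → ℝ => weight n 0 (extendZero t)).map
        fun t => (staircase n).domRestrict (rskChain (extendZero t) n)) =
      (volume.withDensity fun t : staircase n → ℝ => weight n 0 (extendZero t)).map
        fun t => (staircase n).domRestrict (burgeChain (extendZero t) n) := by
  have hz : ∀ u : ℕ × ℕ → ℝ, (∀ p ∉ staircase n, u p = 0) →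
      ∀ p : ℕ × ℕ, p.1 = 0 ∨ p.2 = 0 → u p = 0 := fun u hu p hp => hu p (by
    rintro ⟨h1, h2, -⟩; omega)
  -- Both sides become the measure with density `weight n n`.
  rw [(preservesVolumeOn_rskChain le_rfl).map_withDensity (measurable_weight n n)
      fun u hu => weight_rskChain (hz u hu) le_rfl,
    (preservesVolumeOn_burgeChain le_rfl).map_withDensity (measurable_weight n n)
      fun u hu => weight_burgeChain (hz u hu) le_rfl]

end volume

/-! ### Burge insertion along one diagonal -/

section diagonal

variable {u X : ℕ × ℕ → ℝ}

theorem burgeDiagonal_of_ne {p q : ℕ × ℕ} {k : ℕ} (hp : q ≠ p)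
    (hd : ∀ l < k, q ≠ (p.1 - (l + 1), p.2 - (l + 1))) : burgeDiagonal p k u q = u q := by
  induction k generalizing u with
  | zero => rfl
  | succ k ih =>
    rw [burgeDiagonal, ih fun l hl => hd l (by omega), burgeMove_of_ne u hp (hd k (by omega))]

theorem burgeDiagonal_of_sub_ne {p q : ℕ × ℕ} {k : ℕ} (hk1 : k ≤ p.1) (hk2 : k ≤ p.2)
    (h : (q.1 : ℤ) - q.2 ≠ p.1 - p.2) : burgeDiagonal p k u q = u q := by
  refine burgeDiagonal_of_ne (by rintro rfl; exact h rfl) fun l hl => ?_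
  rintro rfl
  dsimp only at h
  omega

/-- Here `c l` is the entry at `p` once the moves at distances `k`, …, `l + 1` have been made. The
bounds `lo` and `hi` are those of the initial state, as no move touches a neighbour of the diagonal.
-/
theorem exists_burgeDiagonal_eq {p : ℕ × ℕ} {k : ℕ} (hk1 : k < p.1) (hk2 : k < p.2) :
    ∃ c : ℕ → ℝ, c k = u p ∧ burgeDiagonal p k u p = c 0 ∧
      ∀ l < k, ∀ d, d = (p.1 - (l + 1), p.2 - (l + 1)) →
        burgeDiagonal p k u d = hi u d - min (u d - lo u d) (c (l + 1)) ∧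
        c l = c (l + 1) + (hi u d - min (u d - lo u d) (c (l + 1)) - u d) := by
  induction k generalizing u with
  | zero => exact ⟨fun _ => u p, rfl, rfl, fun l hl => by omega⟩
  | succ k ih =>
    set e : ℕ × ℕ := (p.1 - (k + 1), p.2 - (k + 1)) with he
    have hpe : p ≠ e := fun h => by
      have := congrArg Prod.fst h
      simp only [he] at this
      omega
    have hpf : p ∈ flipCells (p.1 + p.2) := mem_flipCells.2 (by omega)
    have hef : e ∈ flipCells (p.1 + p.2) := flipCells_of_diagonal rfl hk1 hk2
    obtain ⟨c, hck, hc0, hc⟩ := ih (u := burgeMove p e u) (by omega) (by omega)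
    have hlast : burgeDiagonal p k (burgeMove p e u) e = burgeMove p e u e :=
      burgeDiagonal_of_ne hpe.symm fun l hl h => by
        have := congrArg Prod.fst h
        simp only [he] at this
        omega
    have hupd : ∀ l ≤ k, Function.update c (k + 1) (u p) l = c l := fun l hl =>
      Function.update_of_ne (by omega) _ _
    refine ⟨Function.update c (k + 1) (u p), Function.update_self _ _ _, ?_, fun l hl d hd => ?_⟩
    · rw [hupd 0 (by omega)]; exact hc0
    · rcases Nat.lt_succ_iff_lt_or_eq.1 hl with hl | rfl
      · have hdf : d ∈ flipCells (p.1 + p.2) := by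
          rw [hd]; exact flipCells_of_diagonal rfl (by omega) (by omega)
        have hdp : d ≠ p := fun h => by
          have := congrArg Prod.fst (hd.symm.trans h)
          dsimp only at this
          omega
        have hde : d ≠ e := fun h => by
          have := congrArg Prod.fst (hd.symm.trans h)
          simp only [he] at this
          omega
        have h := hc l hl d hd
        rw [lo_congr (fun q hq => burgeMove_of_notMem u hpf hef hq) hdf,
          hi_congr (fun q hq => burgeMove_of_notMem u hpf hef hq) hdf,
          burgeMove_of_ne u hdp hde] at h
        rw [hupd l (by omega), hupd (l + 1) (by omega)]
        exact h
      · obtain rfl : d = e := hd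
        rw [Function.update_self, hupd l le_rfl, hck, burgeDiagonal, ← he, hlast,
          burgeMove_left u hpe, burgeMove_right u hpe]
        exact ⟨rfl, rfl⟩

theorem burgeAntidiagonal_of_lt_sub {m a : ℕ} (ha : a < m ∨ a = 0) {q : ℕ × ℕ}
    (hq : (2 * a : ℤ) - m < q.1 - q.2) : burgeAntidiagonal m a u q = u q := by
  induction a with
  | zero => rfl
  | succ a ih =>
    rw [burgeAntidiagonal, burgeDiagonal_of_sub_ne, ih (by omega) (by push_cast at hq; omega)] <;>
      dsimp only <;> omega

theorem burgeAntidiagonal_of_sub_le {m a b : ℕ} (ha : a < m) (hb : b ≤ a) {q : ℕ × ℕ}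
    (hq : (q.1 : ℤ) - q.2 ≤ 2 * b - m) : burgeAntidiagonal m a u q = burgeAntidiagonal m b u q := by
  induction a, hb using Nat.le_induction with
  | base => rfl
  | succ a hb ih =>
    rw [burgeAntidiagonal, burgeDiagonal_of_sub_ne, ih (by omega)] <;> dsimp only <;> omega

theorem burgeAntidiagonal_eq_burgeDiagonal {i j : ℕ} {q : ℕ × ℕ} (hq : (q.1 : ℤ) - q.2 = i - j) :
    burgeAntidiagonal (i + j + 2) (i + j + 1) u q =
      burgeDiagonal (i + 1, j + 1) (min i j) (burgeAntidiagonal (i + j + 2) i u) q := by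
  rw [burgeAntidiagonal_of_sub_le (b := i + 1) (by omega) (by omega) (by push_cast; omega),
    burgeAntidiagonal]
  congr 2 <;> omega

/-- Moves attached to other diagonals do not act on this one. The toggle following the Burge moves
reflects `hi - min` to `lo + min`, so `hi` survives only in the recursion for `c`. -/
theorem exists_burgeChain_eq (i j : ℕ) {v : ℕ × ℕ → ℝ} (hv : v = burgeChain X (i + j + 1)) :
    ∃ c : ℕ → ℝ, c (min i j) = X (i + 1, j + 1) ∧
      burgeChain X (i + j + 2) (i + 1, j + 1) = c 0 + lo v (i + 1, j + 1) ∧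
      ∀ l < min i j, ∀ d, d = (i - l, j - l) →
        burgeChain X (i + j + 2) d = lo v d + min (v d - lo v d) (c (l + 1)) ∧
        c l = c (l + 1) + (hi v d - min (v d - lo v d) (c (l + 1)) - v d) := by
  subst hv
  set v := burgeChain X (i + j + 1) with hv
  set w := burgeAntidiagonal (i + j + 2) i v with hw
  have hwv : ∀ q : ℕ × ℕ, (q.1 : ℤ) - q.2 = i - j → w q = v q := fun q hq =>
    burgeAntidiagonal_of_lt_sub (by omega) (by push_cast; omega)
  have hwf : ∀ q ∉ flipCells (i + j + 2), w q = v q := fun q hq =>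
    burgeAntidiagonal_of_notMem (by omega) hq
  have hzf : ∀ q ∉ flipCells (i + j + 2), burgeAntidiagonal (i + j + 2) (i + j + 1) v q = v q :=
    fun q hq => burgeAntidiagonal_of_notMem (by omega) hq
  have hpf : (i + 1, j + 1) ∈ flipCells (i + j + 2) := mem_flipCells_mk.2 (by omega)
  obtain ⟨c, hck, hc0, hc⟩ := exists_burgeDiagonal_eq (u := w) (p := (i + 1, j + 1)) (k := min i j)
    (by dsimp only; omega) (by dsimp only; omega)
  refine ⟨c, ?_, ?_, fun l hl d hd => ?_⟩
  · rw [hck, hwv _ (by push_cast; ring), hv, burgeChain_of_lt (by dsimp only; omega)]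
  · rw [show i + j + 2 = i + j + 1 + 1 from rfl, burgeChain, rskStep_of_eq _ hpf
      (by dsimp only; omega), lo_congr hzf hpf, ← hv, burgeAntidiagonal_eq_burgeDiagonal
      (by push_cast; ring), hc0]
  · have hdf : d ∈ flipCells (i + j + 2) := by rw [hd, mem_flipCells_mk]; omega
    have hdd : (d.1 : ℤ) - d.2 = i - j := by rw [hd]; dsimp only; omega
    have hds : d.1 + d.2 ≠ i + j + 2 := by rw [hd]; dsimp only; omega
    have h := hc l hl d (by rw [hd]; simp only [Nat.add_sub_add_right])
    rw [lo_congr hwf hdf, hi_congr hwf hdf, hwv d hdd] at h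
    refine ⟨?_, h.2⟩
    rw [show i + j + 2 = i + j + 1 + 1 from rfl, burgeChain, rskStep_of_ne _ hdf hds,
      lo_congr hzf hdf, hi_congr hzf hdf, ← hv, burgeAntidiagonal_eq_burgeDiagonal hdd, h.1]
    ring

end diagonal

/-! ### Burge shapes and their queue recursion -/

/-- The `k`-th part of the partition attached to the cell `(i, j)` by the Burge local moves. -/
noncomputable def burgeShape (X : ℕ × ℕ → ℝ) (i j k : ℕ) : ℝ :=
  burgeChain X (i + j) (i - k, j - k)

section burgeShape

variable {X : ℕ × ℕ → ℝ}

/-- The cell has the parity of `m`, or lies on an axis when the subtraction truncates; in both cases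
step `m + 1` skips it. -/
theorem burgeChain_pred {m : ℕ} {i j k : ℕ} (hm : i + j = m) :
    burgeChain X (m + 1) (i - k, j - k) = burgeChain X m (i - k, j - k) :=
  burgeChain_succ_of_notMem (by rw [mem_flipCells_mk]; omega)

theorem burgeShape_eq_zero
    (hX : ∀ p : ℕ × ℕ, p.1 = 0 ∨ p.2 = 0 → X p = 0) {i j k : ℕ} (h : i ≤ k ∨ j ≤ k) : burgeShape X i j k = 0 :=
  burgeChain_eq_zero hX _ (by dsimp only; omega)

theorem burgeShape_nonneg (hX : ∀ p : ℕ × ℕ, p.1 = 0 ∨ p.2 = 0 → X p = 0)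
    (h0 : ∀ p, 0 ≤ X p) (i j k : ℕ) : 0 ≤ burgeShape X i j k :=
  (interlaced_burgeChain hX h0 _).nonneg _

theorem burgeShape_le_succ (hX : ∀ p : ℕ × ℕ, p.1 = 0 ∨ p.2 = 0 → X p = 0)
    (h0 : ∀ p, 0 ≤ X p) (i j k : ℕ) : burgeShape X i j k ≤ burgeShape X i (j + 1) k := by
  rcases le_or_gt j k with h | h
  · rw [burgeShape_eq_zero hX (Or.inr h)]; exact burgeShape_nonneg hX h0 _ _ _
  rw [burgeShape, burgeShape, ← burgeChain_pred rfl, ← add_assoc]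
  have := (interlaced_burgeChain hX h0 (i + j + 1)).le_up (i - k) (j - k) (by omega)
  rwa [show j + 1 - k = j - k + 1 by omega]

/-- One row insertion, seen as a sequence of queues: `c k` is the row offered to the `k`-th line. -/
theorem exists_burge_services (hX : ∀ p : ℕ × ℕ, p.1 = 0 ∨ p.2 = 0 → X p = 0)
    (h0 : ∀ p, 0 ≤ X p) (i j : ℕ) : ∃ c : ℕ → ℝ, c j = X (i + 1, j + 1) ∧
      burgeShape X (i + 1) (j + 1) 0 = burgeShape X i (j + 1) 0 + c 0 ∧
      ∀ k < j, burgeShape X (i + 1) (j + 1) (k + 1) =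
          min (burgeShape X i j k) (burgeShape X i (j + 1) (k + 1) + c (k + 1)) ∧
        c k = c (k + 1) + (burgeShape X (i + 1) j k - burgeShape X i j k) -
          (burgeShape X (i + 1) (j + 1) (k + 1) - burgeShape X i (j + 1) (k + 1)) := by
  obtain ⟨c, hcr, hc0, hc⟩ := exists_burgeChain_eq (X := X) i j rfl
  set a : ℕ → ℝ := fun k => max (burgeShape X i (j + 1) k) (burgeShape X (i + 1) j k) with ha
  have hv : ∀ k q, q = (i - k, j + 1 - k) →
      burgeChain X (i + j + 1) q = burgeShape X i (j + 1) k := fun k q hq => by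
    rw [burgeShape, hq, add_assoc]
  have hv' : ∀ k q, q = (i + 1 - k, j - k) →
      burgeChain X (i + j + 1) q = burgeShape X (i + 1) j k := fun k q hq => by
    rw [burgeShape, hq, add_right_comm]
  have hlo : ∀ k ≤ min i j, lo (burgeChain X (i + j + 1)) (i + 1 - k, j + 1 - k) = a k := by
    intro k hk
    rw [lo, hv k, hv' k] <;>
      exact Prod.ext (by dsimp only <;> omega) (by dsimp only <;> omega)
  have hmid : ∀ k, burgeChain X (i + j + 1) (i - k, j - k) = burgeShape X i j k := fun k =>
    burgeChain_pred rfl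
  have hhi : ∀ k < min i j, hi (burgeChain X (i + j + 1)) (i - k, j - k) =
      min (burgeShape X i (j + 1) k) (burgeShape X (i + 1) j k) := by
    intro k hk
    rw [hi, hv' k, hv k, min_comm] <;>
      exact Prod.ext (by dsimp only <;> omega) (by dsimp only <;> omega)
  -- The service is the mass carried along the diagonal plus the excess of `lo` over the part at (i,
  -- j + 1). Past the end of the diagonal the mass is the inserted weight itself.
  refine ⟨fun k => (if k < min i j then c k else X (i + 1, j + 1)) + a k -
    burgeShape X i (j + 1) k, ?_, ?_, fun k hk => ?_⟩
  · have : a j = burgeShape X i (j + 1) j := by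
      simp only [ha]
      rw [burgeShape_eq_zero hX (i := i + 1) (Or.inr le_rfl)]
      exact max_eq_left (burgeShape_nonneg hX h0 _ _ _)
    simp [this]
  · have h1 : (if 0 < min i j then c 0 else X (i + 1, j + 1)) = c 0 := by
      split_ifs with h
      · rfl
      · rw [← hcr]; congr 1; omega
    have h2 : burgeShape X (i + 1) (j + 1) 0 = c 0 + a 0 := by
      rw [← hlo 0 (Nat.zero_le _), burgeShape, Nat.sub_zero, Nat.sub_zero, ← hc0]
      congr 1; ring
    dsimp only
    rw [h1, h2]; ring
  · dsimp only
    rcases lt_or_ge k (min i j) with hkr | hkr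
    · have h1 : (if k + 1 < min i j then c (k + 1) else X (i + 1, j + 1)) = c (k + 1) := by
        split_ifs with h
        · rfl
        · rw [← hcr]; congr 1; omega
      have hlo' : lo (burgeChain X (i + j + 1)) (i - k, j - k) = a (k + 1) := by
        rw [← hlo (k + 1) (by omega), Nat.add_sub_add_right, Nat.add_sub_add_right]
      have h := hc k hkr _ rfl
      rw [hlo', hmid, hhi k hkr] at h
      have hN : burgeShape X (i + 1) (j + 1) (k + 1) =
          a (k + 1) + min (burgeShape X i j k - a (k + 1)) (c (k + 1)) := by
        rw [← h.1, burgeShape, Nat.add_sub_add_right, Nat.add_sub_add_right]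
        congr 1; ring
      have hab : a k + min (burgeShape X i (j + 1) k) (burgeShape X (i + 1) j k) =
          burgeShape X i (j + 1) k + burgeShape X (i + 1) j k := max_add_min _ _
      rw [h1, if_pos hkr, hN]
      constructor
      · rw [← min_add_add_left]
        congr 1 <;> ring
      · linarith [h.2]
    · have hN : burgeShape X (i + 1) (j + 1) (k + 1) = 0 := burgeShape_eq_zero hX (by omega)
      have hP : burgeShape X i (j + 1) (k + 1) = 0 := burgeShape_eq_zero hX (by omega)
      have hP' : burgeShape X i (j + 1) k = 0 := burgeShape_eq_zero hX (by omega)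
      have hM : burgeShape X i j k = 0 := burgeShape_eq_zero hX (by omega)
      have hO : burgeShape X (i + 1) j (k + 1) = 0 := burgeShape_eq_zero hX (by omega)
      have hO' := burgeShape_nonneg hX h0 (i + 1) j k
      simp only [ha, hN, hP, hP', hM, hO, max_self, max_eq_right hO', if_neg (not_lt.2 hkr),
        if_neg (not_lt.2 (hkr.trans k.le_succ))]
      simp [h0]

end burgeShape

/-! ### Passage through lines and exchange through queues -/

/-- Last passage percolation through one more line with weights `y`, entered at the columns
`b ≥ 1` at heights `h b`. -/
noncomputable def lineOp (y h : ℕ → ℝ) : ℕ → ℝ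
  | 0 => 0
  | b + 1 => max (lineOp y h b) (h (b + 1)) + y (b + 1)

/-- Last passage percolation through the lines `ys (k - 1), …, ys 0`. -/
noncomputable def stackOp (ys : ℕ → ℕ → ℝ) : ℕ → (ℕ → ℝ) → ℕ → ℝ
  | 0, h => h
  | k + 1, h => stackOp ys k (lineOp (ys k) h)

/-- The increments of a function. -/
def increment (f : ℕ → ℝ) (b : ℕ) : ℝ := f b - f (b - 1)

theorem increment_succ (f : ℕ → ℝ) (b : ℕ) : increment f (b + 1) = f (b + 1) - f b := rfl

theorem lineOp_congr {y y' h : ℕ → ℝ} (hy : ∀ b, y (b + 1) = y' (b + 1)) :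
    lineOp y h = lineOp y' h := by
  funext b
  induction b with
  | zero => rfl
  | succ b ih => rw [lineOp, lineOp, ih, hy]

theorem lineOp_increment {f g : ℕ → ℝ} (hf : f 0 = 0) (hg : ∀ b, g (b + 1) ≤ f b) :
    lineOp (increment f) g = f := by
  funext b
  induction b with
  | zero => exact hf.symm
  | succ b ih => rw [lineOp, ih, max_eq_left (hg b), increment_succ]; ring

/-- Exchanging two lines through a queue with arrivals `increment Y`, services `x` and departures
`increment P` preserves last passage percolation. -/
theorem lineOp_lineOp_queue {x c P Y : ℕ → ℝ} (h0 : P 0 = Y 0)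
    (hP : ∀ b, P (b + 1) = min (Y b) (P b + x (b + 1)))
    (hc : ∀ b, c (b + 1) = x (b + 1) + (Y (b + 1) - Y b) - (P (b + 1) - P b)) (h : ℕ → ℝ) :
    lineOp (increment Y) (lineOp x h) = lineOp c (lineOp (increment P) h) := by
  -- `Y b - P b` is the content of the queue. The last two clauses say that either the passages
  -- through `x` and through the departures agree, or the two-line passage exceeds the one through
  -- `x` by exactly this content; this dichotomy propagates the equality.
  have key : ∀ b, lineOp (increment Y) (lineOp x h) b = lineOp c (lineOp (increment P) h) b ∧
      lineOp (increment P) h b ≤ lineOp x h b ∧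
      lineOp (increment Y) (lineOp x h) b ≤ lineOp x h b + (Y b - P b) ∧
      (lineOp (increment P) h b = lineOp x h b ∨
        lineOp x h b + (Y b - P b) ≤ lineOp (increment Y) (lineOp x h) b) := by
    intro b
    induction b with
    | zero => simp [lineOp, h0]
    | succ b ih =>
      obtain ⟨h1, h2, h3, h4⟩ := ih
      simp only [lineOp, increment_succ, hc, ← h1]
      have hPb := hP b
      generalize lineOp (increment Y) (lineOp x h) b = F at *
      generalize lineOp (increment P) h b = f' at *
      generalize lineOp x h b = f at *
      generalize h (b + 1) = η at *
      generalize x (b + 1) = ξ at *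
      generalize P (b + 1) = P1 at *
      generalize Y (b + 1) = Y1 at *
      generalize P b = P0 at *
      generalize Y b = Y0 at *
      subst hPb
      clear h1
      rcases h4 with rfl | h4 <;> grind
  exact funext fun b => (key b).1

/-! ### First parts as passage times -/

section burge

variable {X : ℕ × ℕ → ℝ}

/-- Induction on the number of rows. The new row is crossed first; it is moved past the lines `j -
1`, …, 0 by queue exchanges. Each replaces the part `k` for `j` by the part `k + 1` for `j + 1` and
leaves the services `c k`; the last services `c 0` are the increments of the new first part. -/
theorem stackOp_burgeShape (hX : ∀ p : ℕ × ℕ, p.1 = 0 ∨ p.2 = 0 → X p = 0) (h0 : ∀ p, 0 ≤ X p)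
    (j : ℕ) (f : ℕ → ℝ) :
    stackOp (fun k => increment fun i => burgeShape X i j k) j f =
      stackOp (fun k i => X (i, k + 1)) j f := by
  induction j generalizing f with
  | zero => rfl
  | succ j ih =>
    choose c hcj hc0 hc using fun i => exists_burge_services hX h0 i j
    have key : ∀ k ≤ j, ∀ g : ℕ → ℝ, stackOp (fun k => increment fun i => burgeShape X i j k) k
        (lineOp (fun i => c (i - 1) k) g) =
          stackOp (fun k => increment fun i => burgeShape X i (j + 1) k) (k + 1) g := by
      intro k
      induction k with
      | zero =>
        intro _ g
        refine lineOp_congr fun b => ?_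
        change c b 0 = burgeShape X (b + 1) (j + 1) 0 - burgeShape X b (j + 1) 0
        rw [hc0 b]; ring
      | succ k ihk =>
        intro hk g
        rw [stackOp, lineOp_lineOp_queue (P := fun i => burgeShape X i (j + 1) (k + 1))
          (c := fun i => c (i - 1) k), ihk (by omega)]
        · rfl
        · exact (burgeShape_eq_zero hX (Or.inl (Nat.zero_le _))).trans
            (burgeShape_eq_zero hX (Or.inl (Nat.zero_le _))).symm
        · exact fun b => (hc b k (by omega)).1
        · exact fun b => (hc b k (by omega)).2
    rw [← key j le_rfl, ih, stackOp]
    congr 1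
    exact lineOp_congr fun b => hcj b

/-- Starting from the part `j`, which is zero, the line of the part `k` is entered at the heights of
the part `k + 1`. Since the part `k + 1` at `b + 1` is at most the part `k` at `b`, the passage
never gains by entering late, and it yields the part `k`. -/
theorem burgeChain_eq_stackOp (hX : ∀ p : ℕ × ℕ, p.1 = 0 ∨ p.2 = 0 → X p = 0)
    (h0 : ∀ p, 0 ≤ X p) (i j : ℕ) :
    burgeChain X (i + j) (i, j) = stackOp (fun k i => X (i, k + 1)) j 0 i := by
  have key : ∀ k ≤ j, stackOp (fun k => increment fun i => burgeShape X i j k) k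
      (fun i => burgeShape X i j k) = fun i => burgeShape X i j 0 := by
    intro k
    induction k with
    | zero => intro _; rfl
    | succ k ih =>
      intro hk
      rw [stackOp, lineOp_increment, ih (by omega)]
      · exact burgeShape_eq_zero hX (Or.inl (Nat.zero_le _))
      · intro b
        rcases hk.eq_or_lt with hk | hk
        · rw [burgeShape_eq_zero hX (Or.inr hk.ge)]
          exact burgeShape_nonneg hX h0 _ _ _
        obtain ⟨j, rfl⟩ := Nat.exists_eq_add_of_le' (by omega : 1 ≤ j)
        obtain ⟨c, -, -, hc⟩ := exists_burge_services hX h0 b j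
        rw [(hc k (by omega)).1]
        exact (min_le_left _ _).trans (burgeShape_le_succ hX h0 b j k)
  have hz : (fun i => burgeShape X i j j) = 0 := funext fun i =>
    burgeShape_eq_zero hX (Or.inr le_rfl)
  rw [← stackOp_burgeShape hX h0, ← hz, key j le_rfl]
  rfl

theorem rskChain_succ_succ (X : ℕ × ℕ → ℝ) (i j : ℕ) :
    rskChain X (i + 1 + (j + 1)) (i + 1, j + 1) =
      max (rskChain X (i + (j + 1)) (i, j + 1)) (rskChain X (i + 1 + j) (i + 1, j)) +
        X (i + 1, j + 1) := by
  rw [show i + 1 + (j + 1) = i + j + 1 + 1 by ring, show i + (j + 1) = i + j + 1 by ring,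
    show i + 1 + j = i + j + 1 by ring, rskChain, rskStep_of_eq _ (mem_flipCells_mk.2 (by omega))
    (by dsimp only; omega), rskChain_of_lt (by dsimp only; omega), lo, add_comm]
  rfl

end burge

/-! ### First-step recursion for directed paths -/

section lastPassage

variable {x : ℕ × ℕ → ℝ}

theorem latticeDist_comm (u v : ℕ × ℕ) : latticeDist u v = latticeDist v u := by
  simp only [latticeDist]; omega

theorem latticeDist_triangle (u v w : ℕ × ℕ) :
    latticeDist u w ≤ latticeDist u v + latticeDist v w := by
  simp only [latticeDist]; omega

/-- The sums of the weights `x` along the lattice paths with `d` steps from `u` to `v`. -/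
def pathSums (x : ℕ × ℕ → ℝ) (d : ℕ) (u v : ℕ × ℕ) : Set ℝ :=
  {s | ∃ π : Fin (d + 1) → ℕ × ℕ, π 0 = u ∧ π (Fin.last d) = v ∧
    (∀ k : Fin d, latticeDist (π k.castSucc) (π k.succ) = 1) ∧ ∑ k, x (π k) = s}

theorem isGreatest_pathSums (x : ℕ × ℕ → ℝ) (u v : ℕ × ℕ) :
    IsGreatest (pathSums x (latticeDist u v) u v) (lastPassage x u v) := by
  convert isGreatest_lastPassage x u v using 1
  ext s
  simp only [pathSums, directedPaths, Set.mem_image, Set.mem_ofPred_eq, and_assoc]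

theorem pathSums_reverse_subset (d : ℕ) (u v : ℕ × ℕ) : pathSums x d u v ⊆ pathSums x d v u := by
  rintro s ⟨π, h0, h1, hs, rfl⟩
  refine ⟨fun k => π k.rev, by simpa using h1, by simpa using h0, fun k => ?_, ?_⟩
  · dsimp only
    rw [Fin.rev_castSucc, Fin.rev_succ, latticeDist_comm]
    exact hs k.rev
  · exact Equiv.sum_comp Fin.revPerm fun k => x (π k)

theorem lastPassage_comm (x : ℕ × ℕ → ℝ) (u v : ℕ × ℕ) :
    lastPassage x u v = lastPassage x v u := by
  have h := isGreatest_pathSums x u v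
  rw [latticeDist_comm, (pathSums_reverse_subset _ u v).antisymm (pathSums_reverse_subset _ _ _)]
    at h
  exact h.unique (isGreatest_pathSums x v u)

theorem pathSums_zero (u : ℕ × ℕ) : pathSums x 0 u u = {x u} := by
  ext s
  constructor
  · rintro ⟨π, h0, -, -, rfl⟩; simp [h0]
  · rintro rfl; exact ⟨fun _ => u, rfl, rfl, fun k => k.elim0, by simp⟩

theorem lastPassage_self (x : ℕ × ℕ → ℝ) (u : ℕ × ℕ) : lastPassage x u u = x u := by
  have h := isGreatest_pathSums x u u
  rw [show latticeDist u u = 0 by simp [latticeDist], pathSums_zero] at h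
  exact h.1

theorem mem_pathSums_succ {d : ℕ} {u v : ℕ × ℕ} {s : ℝ} : s ∈ pathSums x (d + 1) u v ↔
    ∃ w, latticeDist u w = 1 ∧ ∃ r ∈ pathSums x d w v, x u + r = s := by
  constructor
  · rintro ⟨π, rfl, rfl, hs, rfl⟩
    refine ⟨π 1, hs 0, ∑ k : Fin (d + 1), x (π k.succ), ⟨fun k => π k.succ, rfl, rfl, fun k => ?_, rfl⟩,
      (Fin.sum_univ_succ fun k => x (π k)).symm⟩
    exact hs k.succ
  · rintro ⟨w, hw, r, ⟨π, rfl, rfl, hs, rfl⟩, rfl⟩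
    refine ⟨Fin.cons u π, rfl, rfl, fun k => ?_, by simp [Fin.sum_univ_succ]⟩
    refine Fin.cases hw (fun k => ?_) k
    exact hs k

theorem latticeDist_le_of_mem_pathSums {d : ℕ} {u v : ℕ × ℕ} {s : ℝ} (h : s ∈ pathSums x d u v) :
    latticeDist u v ≤ d := by
  induction d generalizing u s with
  | zero => obtain ⟨π, rfl, rfl, -⟩ := h; simp [latticeDist]
  | succ d ih =>
    obtain ⟨w, hw, r, hr, -⟩ := mem_pathSums_succ.1 h
    have := latticeDist_triangle u w v
    have := ih hr
    omega

theorem le_lastPassage {d : ℕ} {u v w : ℕ × ℕ} (huv : latticeDist u v = d + 1)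
    (huw : latticeDist u w = 1) (hwv : latticeDist w v = d) :
    x u + lastPassage x w v ≤ lastPassage x u v := by
  have h := isGreatest_pathSums x u v
  rw [huv] at h
  exact h.2 (mem_pathSums_succ.2 ⟨w, huw, _, hwv ▸ (isGreatest_pathSums x w v).1, rfl⟩)

theorem exists_lastPassage_eq (x : ℕ × ℕ → ℝ) {d : ℕ} {u v : ℕ × ℕ}
    (huv : latticeDist u v = d + 1) : ∃ w, latticeDist u w = 1 ∧ latticeDist w v = d ∧
      lastPassage x u v = x u + lastPassage x w v := by
  have h := isGreatest_pathSums x u v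
  rw [huv] at h
  obtain ⟨w, hw, r, hr, hs⟩ := mem_pathSums_succ.1 h.1
  have h1 := latticeDist_triangle u w v
  have hwv : latticeDist w v = d := by
    have := latticeDist_le_of_mem_pathSums hr
    omega
  refine ⟨w, hw, hwv, le_antisymm ?_ (le_lastPassage huv hw hwv)⟩
  rw [← hs]
  have := (isGreatest_pathSums x w v).2 (hwv.symm ▸ hr)
  linarith

end lastPassage

/-! ### Passage tables -/

/-- Last passage percolation from the first line through the lines `ys 0, …, ys (k - 1)`. -/
noncomputable def passageTable (ys : ℕ → ℕ → ℝ) : ℕ → ℕ → ℝ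
  | 0 => 0
  | k + 1 => lineOp (ys k) (passageTable ys k)

section passageTable

variable {ys : ℕ → ℕ → ℝ}

theorem passageTable_zero_right (k : ℕ) : passageTable ys k 0 = 0 := by
  cases k <;> rfl

theorem passageTable_succ_succ (k b : ℕ) : passageTable ys (k + 1) (b + 1) =
    max (passageTable ys (k + 1) b) (passageTable ys k (b + 1)) + ys k (b + 1) := rfl

theorem passageTable_nonneg (h : ∀ k b, 0 ≤ ys k b) (k b : ℕ) : 0 ≤ passageTable ys k b := by
  induction b generalizing k with
  | zero => rw [passageTable_zero_right]
  | succ b ih =>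
    cases k with
    | zero => exact le_rfl
    | succ k => exact add_nonneg (le_max_of_le_left (ih (k + 1))) (h _ _)

theorem stackOp_eq_passageTable (j : ℕ) :
    stackOp ys j 0 = passageTable (fun k => ys (j - 1 - k)) j := by
  have key : ∀ s ≤ j, stackOp ys (j - s) (passageTable (fun k => ys (j - 1 - k)) s) =
      stackOp ys j 0 := by
    intro s
    induction s with
    | zero => intro _; rfl
    | succ s ih =>
      intro hs
      rw [← ih (by omega), show j - s = j - (s + 1) + 1 by omega, stackOp, passageTable,
        show j - 1 - s = j - (s + 1) by omega]
  rw [← key j le_rfl, Nat.sub_self]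
  rfl

/-- Last passage times to the corner `c 0 0` of a rectangular array `c` of cells. -/
theorem lastPassage_eq_passageTable {x : ℕ × ℕ → ℝ} (hys : ∀ k b, 0 ≤ ys k b) {c : ℕ → ℕ → ℕ × ℕ}
    {R : ℕ → ℕ → Prop} (hR : ∀ i j, R (i + 1) j → R i j) (hR' : ∀ i j, R i (j + 1) → R i j)
    (hx : ∀ i j, R i j → ys j (i + 1) = x (c i j))
    (hdist : ∀ i j, R i j → latticeDist (c i j) (c 0 0) = i + j)
    (hstep : ∀ i j, R (i + 1) j → latticeDist (c (i + 1) j) (c i j) = 1)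
    (hstep' : ∀ i j, R i (j + 1) → latticeDist (c i (j + 1)) (c i j) = 1)
    (hnext : ∀ i j w, R i j → latticeDist (c i j) w = 1 →
      latticeDist w (c 0 0) + 1 = i + j → (∃ i', i = i' + 1 ∧ w = c i' j) ∨
        ∃ j', j = j' + 1 ∧ w = c i j') {i j : ℕ} (h : R i j) :
    lastPassage x (c i j) (c 0 0) = passageTable ys (j + 1) (i + 1) := by
  obtain ⟨d, hd⟩ : ∃ d, i + j = d := ⟨_, rfl⟩
  induction d generalizing i j with
  | zero =>
    obtain ⟨rfl, rfl⟩ : i = 0 ∧ j = 0 := by omega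
    rw [lastPassage_self, passageTable_succ_succ, passageTable_zero_right, ← hx 0 0 h]
    simp [passageTable]
  | succ d ih =>
    have hdij : latticeDist (c i j) (c 0 0) = d + 1 := by rw [hdist i j h, hd]
    rw [passageTable_succ_succ, add_comm, hx i j h]
    apply le_antisymm
    · obtain ⟨w, hw, hwd, hL⟩ := exists_lastPassage_eq x hdij
      rw [hL]
      gcongr
      rcases hnext i j w h hw (by omega) with ⟨i, rfl, rfl⟩ | ⟨j, rfl, rfl⟩
      · rw [ih (hR _ _ h) (by omega)]; exact le_max_left _ _
      · rw [ih (hR' _ _ h) (by omega)]; exact le_max_right _ _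
    · rw [← max_add_add_left]
      have hnear : ∀ i' j', R i' j' → i' + j' = d → latticeDist (c i j) (c i' j') = 1 →
          x (c i j) + passageTable ys (j' + 1) (i' + 1) ≤ lastPassage x (c i j) (c 0 0) := by
        intro i' j' hR hd' hw
        rw [← ih hR hd']
        exact le_lastPassage hdij hw (by rw [hdist i' j' hR, hd'])
      -- Row and column 0 of the table are zero and stand for missing neighbours; as the table is
      -- nonnegative, the existing neighbour attains the maximum.
      refine max_le ?_ ?_
      · cases i with
        | zero =>
          obtain ⟨j, rfl⟩ : ∃ j', j = j' + 1 := ⟨d, by omega⟩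
          refine le_trans ?_ (hnear 0 j (hR' _ _ h) (by omega) (hstep' _ _ h))
          rw [passageTable_zero_right]
          gcongr
          exact passageTable_nonneg hys _ _
        | succ i => exact hnear i j (hR _ _ h) (by omega) (hstep _ _ h)
      · cases j with
        | zero =>
          obtain ⟨i, rfl⟩ : ∃ i', i = i' + 1 := ⟨d, by omega⟩
          refine le_trans ?_ (hnear i 0 (hR _ _ h) (by omega) (hstep _ _ h))
          gcongr
          exact passageTable_nonneg hys _ _
        | succ j => exact hnear i j (hR' _ _ h) (by omega) (hstep' _ _ h)

end passageTable

/-! ### The arrays as last passage times -/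

section chains

variable {x X : ℕ × ℕ → ℝ} {n : ℕ}

theorem rskChain_eq_passageTable (hX : ∀ p : ℕ × ℕ, p.1 = 0 ∨ p.2 = 0 → X p = 0) (i j : ℕ) :
    rskChain X (i + j) (i, j) = passageTable (fun k b => X (b, k + 1)) j i := by
  induction i generalizing j with
  | zero => rw [rskChain_eq_zero hX _ (Or.inl rfl), passageTable_zero_right]
  | succ i ih =>
    induction j with
    | zero => rw [rskChain_eq_zero hX _ (Or.inr rfl)]; rfl
    | succ j ihj => rw [rskChain_succ_succ, ih, ihj, passageTable_succ_succ]

theorem lastPassage_eq_rskChain (hX : ∀ p : ℕ × ℕ, p.1 = 0 ∨ p.2 = 0 → X p = 0)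
    (h0 : ∀ p, 0 ≤ X p) (hxX : ∀ p ∈ staircase n, X p = x p) {i j : ℕ} (hi : 1 ≤ i) (hj : 1 ≤ j)
    (hij : i + j ≤ n) : lastPassage x (1, 1) (i, j) = rskChain X (i + j) (i, j) := by
  obtain ⟨i, rfl⟩ := Nat.exists_eq_add_of_le' hi
  obtain ⟨j, rfl⟩ := Nat.exists_eq_add_of_le' hj
  -- The table describes passage to the corner (1, 1), so the paths are reversed.
  rw [lastPassage_comm, rskChain_eq_passageTable hX]
  refine lastPassage_eq_passageTable (fun k b => h0 _) (c := fun i j => (i + 1, j + 1))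
    (R := fun i j => i + 1 + (j + 1) ≤ n) ?_ ?_ ?_ ?_ ?_ ?_ ?_ hij
  · intro i j h; omega
  · intro i j h; omega
  · intro i j h; exact hxX _ ⟨by simp, by simp, h⟩
  · intro i j _; simp only [latticeDist]; omega
  · intro i j _; simp only [latticeDist]; omega
  · intro i j _; simp only [latticeDist]; omega
  · rintro i j ⟨a, b⟩ _ h1 h2
    simp only [latticeDist] at h1 h2
    by_cases h : b = j + 1
    · exact Or.inl ⟨i - 1, by omega, Prod.ext (by dsimp only; omega) h⟩
    · exact Or.inr ⟨j - 1, by omega, Prod.ext (by dsimp only; omega) (by dsimp only; omega)⟩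

theorem lastPassage_eq_burgeChain (hX : ∀ p : ℕ × ℕ, p.1 = 0 ∨ p.2 = 0 → X p = 0)
    (h0 : ∀ p, 0 ≤ X p) (hxX : ∀ p ∈ staircase n, X p = x p) {i j : ℕ} (hi : 1 ≤ i) (hj : 1 ≤ j)
    (hij : i + j ≤ n) : lastPassage x (i, 1) (1, j) = burgeChain X (i + j) (i, j) := by
  obtain ⟨i, rfl⟩ := Nat.exists_eq_add_of_le' hi
  obtain ⟨j, rfl⟩ := Nat.exists_eq_add_of_le' hj
  rw [burgeChain_eq_stackOp hX h0, stackOp_eq_passageTable]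
  -- The corner is now (1, j + 1) and the rows are numbered downwards from it; the starting cell (i
  -- + 1, 1) is the opposite corner of the rectangle.
  have h := lastPassage_eq_passageTable (x := x) (ys := fun k b => X (b, j + 1 - 1 - k + 1))
    (fun k b => h0 _) (c := fun i' j' => (i' + 1, j + 1 - j')) (R := fun i' j' => i' ≤ i ∧ j' ≤ j)
    (i := i) (j := j) ?_ ?_ ?_ ?_ ?_ ?_ ?_ ⟨le_rfl, le_rfl⟩
  · simpa using h
  · intro i j h; omega
  · intro i j h; omega
  · intro i' j' h
    rw [show j + 1 - 1 - j' + 1 = j + 1 - j' by omega]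
    exact hxX _ ⟨by simp, by dsimp only; omega, by dsimp only; omega⟩
  · intro i j _; simp only [latticeDist]; omega
  · intro i j _; simp only [latticeDist]; omega
  · intro i j _; simp only [latticeDist]; omega
  · rintro i' j' ⟨a, b⟩ _ h1 h2
    simp only [latticeDist] at h1 h2
    by_cases h : b = j + 1 - j'
    · exact Or.inl ⟨i' - 1, by omega, Prod.ext (by dsimp only; omega) h⟩
    · exact Or.inr ⟨j' - 1, by omega, Prod.ext (by dsimp only; omega) (by dsimp only; omega)⟩

end chains

/-! ### Exponential weights and the conclusion -/

theorem finite_staircase (n : ℕ) : (staircase n).Finite :=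
  (Set.finite_Iic (n, n)).subset fun p hp => Prod.le_def.2 (by
    obtain ⟨h1, h2, h3⟩ := hp
    dsimp only
    omega)

section law

variable {n : ℕ}

theorem extendZero_staircase_eq_zero (t : staircase n → ℝ) {p : ℕ × ℕ} (hp : p.1 = 0 ∨ p.2 = 0) :
    extendZero t p = 0 :=
  extendZero_of_notMem t (by rintro ⟨h1, h2, -⟩; omega)

theorem energy_zero_extendZero [Fintype (staircase n)] (t : staircase n → ℝ) :
    energy n 0 (extendZero t) = ∑ p, t p := by
  have h0 : antidiagonalSum (extendZero t) 0 = 0 := by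
    simp [antidiagonalSum, extendZero_staircase_eq_zero]
  have hdisj : ((Finset.Ioc 0 n : Finset ℕ) : Set ℕ).PairwiseDisjoint
      (Finset.HasAntidiagonal.antidiagonal : ℕ → Finset (ℕ × ℕ)) := fun a _ b _ hab =>
    Finset.disjoint_left.2 fun p hpa hpb => hab (by
      rw [Finset.HasAntidiagonal.mem_antidiagonal] at hpa hpb
      exact hpa.symm.trans hpb)
  rw [energy, altSum_succ, altSum_zero, h0, sub_zero, zero_add]
  unfold antidiagonalSum
  rw [← Finset.sum_biUnion hdisj]
  have hsub : (staircase n).toFinset ⊆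
      (Finset.Ioc 0 n).biUnion Finset.HasAntidiagonal.antidiagonal := fun p hp => by
    obtain ⟨h1, h2, h3⟩ := Set.mem_toFinset.1 hp
    exact Finset.mem_biUnion.2 ⟨p.1 + p.2, Finset.mem_Ioc.2 ⟨by omega, h3⟩,
      Finset.HasAntidiagonal.mem_antidiagonal.2 rfl⟩
  rw [← Finset.sum_subset hsub fun p _ hp => extendZero_of_notMem t (by simpa using hp),
    Finset.sum_subtype _ (fun p => Set.mem_toFinset) (extendZero t)]
  exact Finset.sum_congr rfl fun p _ => extendZero_coe t p

theorem interlaced_zero_extendZero {t : staircase n → ℝ} :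
    Interlaced 0 (extendZero t) ↔ ∀ p, 0 ≤ t p := by
  refine ⟨fun h p => extendZero_coe t p ▸ h.nonneg p,
    fun h => ⟨fun p => ?_, fun _ _ h => by omega, fun _ _ h => by omega⟩⟩
  by_cases hp : p ∈ staircase n
  · exact (h ⟨p, hp⟩).trans_eq (extendZero_coe t ⟨p, hp⟩).symm
  · exact (extendZero_of_notMem t hp).ge

theorem weight_zero_extendZero [Fintype (staircase n)] (t : staircase n → ℝ) :
    weight n 0 (extendZero t) = ∏ p, exponentialPDF 1 (t p) := by
  rw [weight]
  split_ifs with h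
  · rw [energy_zero_extendZero, ← Finset.sum_neg_distrib, Real.exp_sum,
      ENNReal.ofReal_prod_of_nonneg fun _ _ => (Real.exp_pos _).le]
    refine Finset.prod_congr rfl fun p _ => ?_
    rw [exponentialPDF_of_nonneg (interlaced_zero_extendZero.1 h p), one_mul, one_mul]
  · rw [interlaced_zero_extendZero, not_forall] at h
    obtain ⟨p, hp⟩ := h
    exact (Finset.prod_eq_zero (Finset.mem_univ p)
      (exponentialPDF_of_neg (not_le.1 hp))).symm

theorem pi_expMeasure [Fintype (staircase n)] :
    Measure.pi (fun _ : staircase n => expMeasure 1) =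
    volume.withDensity fun t => weight n 0 (extendZero t) := by
  have h : expMeasure 1 = volume.withDensity (exponentialPDF 1) := rfl
  have : IsProbabilityMeasure (volume.withDensity (exponentialPDF 1)) :=
    h ▸ isProbabilityMeasure_expMeasure one_pos
  simp only [weight_zero_extendZero, h]
  exact pi_withDensity (fun _ => volume) fun _ =>
    (measurable_exponentialPDFReal 1).ennreal_ofReal

end law

/-- If the weights on the staircase are independent with the exponential distribution of rate one,
then the point-to-line and line-to-line last passage vectors are equal in distribution. -/
theorem theorem1p1 {Ω : Type*} [MeasurableSpace Ω] (P : Measure Ω) [IsProbabilityMeasure P]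
    (n : ℕ) (hn : 2 ≤ n) (X : ℕ × ℕ → Ω → ℝ)
    (hlaw : ∀ p ∈ staircase n, HasLaw (X p) (expMeasure 1) P)
    (hindep : iIndepFun (fun p : staircase n => X p) P) :
    IdentDistrib (fun ω => pointToLine n (fun p => X p ω))
      (fun ω => lineToLine n (fun p => X p ω)) P P := by
  have : Fintype (staircase n) := (finite_staircase n).fintype
  have hXm : ∀ p : staircase n, AEMeasurable (X p) P := fun p => (hlaw p p.2).aemeasurable
  set Y : Ω → staircase n → ℝ := fun ω p => X p ω with hY
  have hYm : AEMeasurable Y P := aemeasurable_pi_lambda _ hXm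
  have hYlaw : P.map Y = volume.withDensity fun t => weight n 0 (extendZero t) := by
    rw [hY, (iIndepFun_iff_map_fun_eq_pi_map hXm).1 hindep, ← pi_expMeasure]
    congr 1
    exact funext fun p => (hlaw p p.2).map_eq
  have hYpos : ∀ᵐ ω ∂P, ∀ p, 0 ≤ extendZero (Y ω) p := by
    refine ae_of_ae_map hYm (p := fun t => ∀ p, 0 ≤ extendZero t p) ?_
    rw [hYlaw, ae_withDensity_iff (show Measurable fun t : staircase n → ℝ =>
      weight n 0 (extendZero t) from (measurable_weight n 0).comp measurable_extendZero)]
    -- Nonnegativity is part of `Interlaced 0`, so the density vanishes wherever it fails.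
    refine Filter.Eventually.of_forall fun t ht => ?_
    by_contra h
    exact ht (if_neg fun h' => h h'.nonneg)
  -- Both vectors are almost surely this projection to the antidiagonal `n`, applied to the two
  -- final arrays.
  set F : (staircase n → ℝ) → Fin (n - 1) → ℝ :=
    fun t k => extendZero t (n - (k + 1), k + 1) with hF
  have hFm : Measurable F := measurable_pi_lambda _ fun k =>
    (measurable_pi_apply _).comp measurable_extendZero
  have hRm := (preservesVolumeOn_rskChain (n := n) le_rfl).measurePreserving.measurable
  have hBm := (preservesVolumeOn_burgeChain (n := n) le_rfl).measurePreserving.measurable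
  have hV : (fun ω => pointToLine n fun p => X p ω) =ᵐ[P] fun ω =>
      F ((staircase n).domRestrict (rskChain (extendZero (Y ω)) n)) := by
    filter_upwards [hYpos] with ω hω
    funext k
    have hk : n - (k + 1) + (k + 1) = n := by omega
    simp only [hF]
    rw [(preservesVolumeOn_rskChain (n := n) le_rfl).extendZero_apply, pointToLine,
      lastPassage_eq_rskChain (n := n) (fun p hp => extendZero_staircase_eq_zero (Y ω) hp) hω
      (fun p hp => extendZero_coe (Y ω) ⟨p, hp⟩) (by omega) (by omega) hk.le, hk]
  have hW : (fun ω => lineToLine n fun p => X p ω) =ᵐ[P] fun ω =>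
      F ((staircase n).domRestrict (burgeChain (extendZero (Y ω)) n)) := by
    filter_upwards [hYpos] with ω hω
    funext k
    have hk : n - (k + 1) + (k + 1) = n := by omega
    simp only [hF]
    rw [(preservesVolumeOn_burgeChain (n := n) le_rfl).extendZero_apply, lineToLine,
      lastPassage_eq_burgeChain (n := n) (fun p hp => extendZero_staircase_eq_zero (Y ω) hp) hω
      (fun p hp => extendZero_coe (Y ω) ⟨p, hp⟩) (by omega) (by omega) hk.le, hk]
  have hR : IdentDistrib (fun ω => (staircase n).domRestrict (rskChain (extendZero (Y ω)) n))
      (fun ω => (staircase n).domRestrict (burgeChain (extendZero (Y ω)) n)) P P := by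
    refine ⟨hRm.comp_aemeasurable hYm, hBm.comp_aemeasurable hYm, ?_⟩
    have h := map_rskChain_eq_map_burgeChain (n := n)
    rwa [← hYlaw, AEMeasurable.map_map_of_aemeasurable hRm.aemeasurable hYm,
      AEMeasurable.map_map_of_aemeasurable hBm.aemeasurable hYm] at h
  have hFR := hR.comp hFm
  exact ((IdentDistrib.of_ae_eq (hFR.aemeasurable_fst.congr hV.symm) hV).trans hFR).trans
    (IdentDistrib.of_ae_eq (hFR.aemeasurable_snd.congr hW.symm) hW).symm
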